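/- **Setting.** Let $(E,\mu)$ be a $\sigma$-finite measure space (the index space; a repeated index is integrated against $\mu$, i.e. summed over if $\mu$ is the counting measure) and let $A$ be a commutative real Banach algebra (for instance $\mathbb C$). Let $G_F:E\times E\to A$ be a symmetric, bounded, measurable propagator. A planar theory with propagator $G_F$ is given by amputated planar 1PI Green's functions $\mathrm{AI}^{(n)}\in L^1(E^n;A)$ and planar connected Green's functions $\mathrm W^{(n)}:E^n\to A$, bounded and measurable for each $n$, which are related by the planar Legendre transform: with $\mathrm W[j]=\sum_n \mathrm W^{(n)}_{j_1\cdots j_n}j_1\cdots j_n$ (non-commuting sources), $\Phi_i=\partial \mathrm W[j]/\partial j_i$ (the planar derivative, which removes a first letter) and $\Gamma[\Phi]=-\Phi G_F^{-1}\Phi+\sum_n \mathrm{AI}^{(n)}_{y_1\cdots y_n}\Phi_{y_1}\cdots\Phi_{y_n}$, one has $\partial\Gamma/\partial\Phi_i=-j_i$, that is, coefficientwise in the sources, $$\Phi_i=\int_E G_F(i,l)\Big(j_l+\sum_{m\ge 0}\int_{E^m}\mathrm{AI}^{(m+1)}_{l\,y_1\cdots y_m}\,\Phi_{y_1}\cdots\Phi_{y_m}\,dy\Big)dl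 .$$ The 1PI functions are $\mathrm I^{(n)}_{j_1\cdots j_n}=\int \mathrm{AI}^{(n)}_{y_1\cdots y_n}\prod_k G_F(j_k,y_k)\,dy$. The partially amputated function $\mathrm{PI}^{(n)}_{a_1\cdots a_n}$ is obtained from $\mathrm{AI}^{(n)}$ by attaching propagators in this way only at those $a_i$ which are external letters. Assume that tadpoles are removed, $\mathrm I^{(1)}=0$, and that the self-energy series converges: the kernels of $(G_F\mathrm{AI}^{(2)})^pG_F$, $p\ge0$, are bounded by constants $c_p$ with $\sum_p c_p<\infty$. **The maps.** Let $J$ be the alphabet of the sources and $X_n=\{x_1,x_1',\dots,x_n,x_n'\}$. For a word $a=a_1\cdots a_N$ in $J\sqcup X_{i-1}$ put $$R^{(i)}(a)=\sum_{I_1\sqcup I_2\sqcup I_3=[N],\;1\in I_1,\;I_2\ne\emptyset}a_{I_1}x_ia_{I_3}\otimes x_i'a_{I_2},$$ the sum being over successive intervals $I_1,I_2,I_3$ ($I_3$ possibly empty), extended linearly, and $\mathcal R^{(0)}=\mathrm{id}$, $\mathcal R^{(n)}=(R^{(n)}\otimes\mathrm{id}^{\otimes(n-1)})\circ\cdots\circ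 R^{(1)}$. A decreasing planar rooted tree with $n$ inner vertices has its inner vertices (the vertices other than the root and the leaves, each with at least one child) decorated bijectively by $x_1,\dots,x_n$ with strictly decreasing index along every path away from the root; its root is decorated by the first source letter and its leaves, from left to right, by the remaining ones. Such a tree has one monomial for each vertex other than the leaves: $j_1$ (root), respectively $x_i'$ (inner vertex $x_i$), followed by the decorations of the children. Its symmetry factor $\gamma(T)$ is the number of decorations of the inner vertices of the underlying undecorated tree that make it decreasing. For a tensor product $O=O_1\otimes\cdots\otimes O_{n}$ of monomials in $J\sqcup X_{n-1}$, let $\mathrm{amp}(O)$ be the integral over all $x_i,x_i'$ of $\prod_a\mathrm{PI}_{O_a}\prod_{i<n} G_F(x_i,x_i')$. Let $\gamma(O)$ be the symmetry factor of the decreasing tree with monomials $O_1,\dots,O_n$, and let $F_{\mathrm I}^{(n)}(O)=\gamma(O)^{-1}\mathrm{amp}(O)$, extended linearly. **Theorem.** For all $k\ge1$ and all words $j_1\cdots j_k$ of sources, the following series converges and $$\tau_{\mathrm W}(j_1\cdots j_k)=\mathrm W^{(k)}_{j_1\cdots j_k}=\delta_{k,2}\,G_F(j_1,j_2)+\sum_{n>0}F_{\mathrm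 I}^{(n)}\circ\mathcal R^{(n-1)}(j_1\cdots j_k).$$ The term $\delta_{k,2}G_F(j_1,j_2)$ is the diagram that consists of a bare propagator. Moreover, for each $n>0$, $$F_{\mathrm I}^{(n)}\circ\mathcal R^{(n-1)}(j_1\cdots j_k)=\sum_T\frac1{\gamma(T)}\,\mathrm{amp}(T),$$ where $T$ runs over the finite set of decreasing planar rooted trees with $n-1$ inner vertices, root decorated by $j_1$ and leaves decorated by $j_2,\dots,j_k$, and $\mathrm{amp}(T)$ is the amplitude of the monomials of $T$. -/

import Mathlib

open MeasureTheory

noncomputable section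

namespace PlanarQFT

/-! Green's functions are functions on words in the index set `E` (the sources `j_i` are labelled
by their index `i : E`), with values in a commutative Banach algebra `A`.  The index set carries a
measure `μ`, and a repeated index is integrated with respect to `μ` (for the counting measure,
it is summed over). -/

/-! ### Words, tensor products of words, and the maps `R` -/

/-- The alphabet `J ⊔ X_n`, where `X_n = {x_1, x_1', …, x_n, x_n'}`.
The pair `x_i, x_i'` is indexed by `i - 1 : Fin n`. -/
abbrev Letter (J : Type*) (n : ℕ) := J ⊕ (Fin n ⊕ Fin n)

namespace Letter

variable {J : Type*} {n : ℕ}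

/-- An external letter. -/
abbrev ext (j : J) : Letter J n := Sum.inl j

/-- The unprimed letter `x_i`. -/
abbrev x (i : Fin n) : Letter J n := Sum.inr (Sum.inl i)

/-- The primed letter `x_i'`. -/
abbrev xp (i : Fin n) : Letter J n := Sum.inr (Sum.inr i)

/-- The inclusion `J ⊔ X_n ⊆ J ⊔ X_{n+1}`. -/
def up : Letter J n → Letter J (n + 1) :=
  Sum.map id (Sum.map Fin.castSucc Fin.castSucc)

end Letter

/-- The span of the words in the alphabet `Y`, i.e. the tensor algebra with its basis of words. -/
abbrev Words (Y : Type*) := List Y →₀ ℝ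

/-- The span of the tensor products `O_1 ⊗ ⋯ ⊗ O_r` of words in the alphabet `Y`; such a tensor
product is recorded as the list `[O_1, …, O_r]`. -/
abbrev Tensors (Y : Type*) := List (List Y) →₀ ℝ

/-- A word, as a basis vector. -/
abbrev word {Y : Type*} (w : List Y) : Words Y := Finsupp.single w 1

/-- `(R^{(n+1)} ⊗ id ⊗ ⋯ ⊗ id)(a ⊗ O_2 ⊗ ⋯ ⊗ O_r)
= ∑ a_{I_1} x_{n+1} a_{I_3} ⊗ x_{n+1}' a_{I_2} ⊗ O_2 ⊗ ⋯ ⊗ O_r`, where the sum is over the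
decompositions of the word `a` into three successive intervals of positions
`I_1 = {1, …, p}`, `I_2 = {p+1, …, q}`, `I_3 = {q+1, …, |a|}` with `I_1` and `I_2` nonempty. -/
def stepOnTensor {J : Type*} {n : ℕ} : List (List (Letter J n)) → Tensors (Letter J (n + 1))
  | [] => 0
  | a :: O =>
      ∑ p ∈ Finset.Icc 1 a.length, ∑ q ∈ Finset.Icc (p + 1) a.length,
        Finsupp.single
          (((a.take p).map Letter.up ++ Letter.x (Fin.last n) :: (a.drop q).map Letter.up) ::
            (Letter.xp (Fin.last n) :: ((a.drop p).take (q - p)).map Letter.up) ::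
            O.map (List.map Letter.up)) 1

/-- The linear map `R^{(n+1)} ⊗ id ⊗ ⋯ ⊗ id`. -/
def step (J : Type*) (n : ℕ) : Tensors (Letter J n) →ₗ[ℝ] Tensors (Letter J (n + 1)) :=
  Finsupp.linearCombination ℝ stepOnTensor

/-- The iterated map `𝓡^{(n)} = (R^{(n)} ⊗ id^{⊗(n-1)}) ∘ ⋯ ∘ R^{(1)}`, with `𝓡^{(0)} = id`. -/
def iterR (J : Type*) : (n : ℕ) → Words J →ₗ[ℝ] Tensors (Letter J n)
  | 0 => Finsupp.linearCombination ℝ fun w => Finsupp.single [w.map Letter.ext] 1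
  | n + 1 => step J n ∘ₗ iterR J n

/-! ### Decreasing planar rooted trees -/

/-- Planar forests (finite ordered lists of planar trees) with leaves decorated by `J` and inner
vertices decorated by `L`: the empty forest; a forest whose first tree is a leaf; a forest whose
first tree has an inner vertex with label `l` and forest of children `c` at its bottom. -/
inductive Forest (L J : Type*) where
  | nil : Forest L J
  | leaf (j : J) (rest : Forest L J) : Forest L J
  | node (l : L) (c : Forest L J) (rest : Forest L J) : Forest L J

namespace Forest

variable {L J : Type*}

/-- The decorations of the leaves, from left to right. -/
def leaves : Forest L J → List J
  | nil => []
  | leaf j f => j :: f.leaves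
  | node _ c f => c.leaves ++ f.leaves

/-- The decorations of the inner vertices. -/
def labels : Forest L J → List L
  | nil => []
  | leaf _ f => f.labels
  | node l c f => l :: (c.labels ++ f.labels)

/-- The decorations of inner vertices strictly decrease along every path away from the root
(and an inner vertex has at least one child). -/
def Decreasing [LT L] : Forest L J → Prop
  | nil => True
  | leaf _ f => f.Decreasing
  | node l c f => c ≠ nil ∧ (∀ m ∈ c.labels, m < l) ∧ c.Decreasing ∧ f.Decreasing

/-- Erase the decorations of the inner vertices. -/
def erase : Forest L J → Forest Unit J
  | nil => nil
  | leaf j f => leaf j f.erase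
  | node _ c f => node () c.erase f.erase

/-- The word read on the lowest vertices of the forest, from left to right: a leaf contributes its
external letter and the inner vertex labelled `i` contributes `x_i`. -/
def bottom {n : ℕ} : Forest (Fin n) J → List (Letter J n)
  | nil => []
  | leaf j f => Letter.ext j :: f.bottom
  | node i _ f => Letter.x i :: f.bottom

/-- The monomials of the inner vertices: the vertex labelled `i` with children `c` gives the letter
`x_i'` followed by the letters of its children. -/
def monomials {n : ℕ} : Forest (Fin n) J → List (List (Letter J n))
  | nil => []
  | leaf _ f => f.monomials
  | node i c f => (Letter.xp i :: c.bottom) :: (c.monomials ++ f.monomials)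

end Forest

/-- Planar rooted trees: a decorated root and the forest of its children. -/
structure Tree (L J : Type*) where
  root : J
  branches : Forest L J

namespace Tree

variable {L J : Type*} {n : ℕ}

/-- Erase the decorations of the inner vertices. -/
def erase (T : Tree L J) : Tree Unit J := ⟨T.root, T.branches.erase⟩

/-- A decreasing tree with `n` inner vertices: these are decorated bijectively by `x_1, …, x_n`,
decreasingly along every path away from the root. -/
def IsDecreasing (T : Tree (Fin n) J) : Prop :=
  T.branches.Decreasing ∧ T.branches.labels.Perm (List.finRange n)

/-- The monomials of all the vertices other than the leaves, the one of the root coming first. -/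
def monomials (T : Tree (Fin n) J) : List (List (Letter J n)) :=
  (Letter.ext T.root :: T.branches.bottom) :: T.branches.monomials

/-- The symmetry factor of a decreasing tree: the number of decorations of the inner vertices of
the underlying undecorated tree that make it a decreasing tree. -/
def symmetryFactor (T : Tree (Fin n) J) : ℕ :=
  {T' : Tree (Fin n) J | T'.IsDecreasing ∧ T'.erase = T.erase}.ncard

end Tree

/-- The decreasing planar rooted trees with `n` inner vertices, root decorated by `j`, and leaves
decorated, from left to right, by the letters of `w`. -/
def decreasingTrees {J : Type*} (n : ℕ) (j : J) (w : List J) : Set (Tree (Fin n) J) :=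
  {T | T.IsDecreasing ∧ T.root = j ∧ T.branches.leaves = w}

/-- The symmetry factor of a tensor product of monomials: the one of the decreasing tree whose
vertices carry these monomials. -/
def symmetryFactor {J : Type*} {n : ℕ} (O : List (List (Letter J n))) : ℕ :=
  {T' : Tree (Fin n) J | T'.IsDecreasing ∧
    ∃ T : Tree (Fin n) J, T.IsDecreasing ∧ T.monomials.Perm O ∧ T'.erase = T.erase}.ncard

/-! ### 1PI Green's functions and the Feynman rule -/

section Feynman

variable {E A : Type*} [MeasurableSpace E] (μ : Measure E)
  [NormedCommRing A] [NormedAlgebra ℝ A] (G : E → E → A)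

/-- Partially amputated Green's function obtained from the amputated one `AI`: an external letter
`Sum.inl j` is replaced by a new variable `y`, multiplied by the propagator `G j y`, and integrated
over; an internal letter `Sum.inr z` is kept as an argument of the amputated function. -/
def partiallyAmputated : (List E → A) → List (E ⊕ E) → A
  | AI, [] => AI []
  | AI, Sum.inl j :: a => ∫ y, G j y * partiallyAmputated (fun b => AI (y :: b)) a ∂μ
  | AI, Sum.inr z :: a => partiallyAmputated (fun b => AI (z :: b)) a

/-- The (non-amputated) 1PI Green's function `I_{j_1⋯j_n} = AI_{y_1⋯y_n} ∏ G_F(j_k, y_k)`. -/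
def onePI (AI : List E → A) (w : List E) : A :=
  partiallyAmputated μ G AI (w.map Sum.inl)

/-- The external letters stand for external parameters; the letters `x_i` and `x_i'` stand for the
internal parameters `z.1 i` and `z.2 i`. -/
def evalLetter {n : ℕ} (z : (Fin n → E) × (Fin n → E)) : Letter E n → E ⊕ E
  | Sum.inl j => Sum.inl j
  | Sum.inr (Sum.inl i) => Sum.inr (z.1 i)
  | Sum.inr (Sum.inr i) => Sum.inr (z.2 i)

/-- The amplitude of a tensor product of monomials: the product of the partially amputated 1PI
functions of the monomials and of the propagators `G_F(x_i, x_i')`, integrated over all the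
`x_i` and `x_i'`. -/
def amplitude (AI : List E → A) {n : ℕ} (O : List (List (Letter E n))) : A :=
  ∫ z : (Fin n → E) × (Fin n → E),
    (O.map fun a => partiallyAmputated μ G AI (a.map (evalLetter z))).prod *
      ∏ i, G (z.1 i) (z.2 i)
    ∂((Measure.pi fun _ => μ).prod (Measure.pi fun _ => μ))

/-- The Feynman rule `F_I^{(n+1)}`: amplitude divided by the symmetry factor. -/
def feynmanRule (AI : List E → A) (n : ℕ) : Tensors (Letter E n) →ₗ[ℝ] A :=
  Finsupp.linearCombination ℝ fun O => (symmetryFactor O : ℝ)⁻¹ • amplitude μ G AI O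

/-! ### Connected Green's functions and the planar Legendre transform -/

/-- The linear form on words associated with the connected Green's functions `W`. -/
def tau (W : List E → A) : Words E →ₗ[ℝ] A := Finsupp.linearCombination ℝ W

/-- Product of generating series in the noncommuting sources; a series is given by its coefficients,
as a function on words. -/
def seriesMul (f g : List E → A) (w : List E) : A :=
  ∑ i ∈ Finset.range (w.length + 1), f (w.take i) * g (w.drop i)

/-- Ordered product of a list of generating series. -/
def seriesProd : List (List E → A) → List E → A
  | [] => fun w => if w.length = 0 then 1 else 0
  | f :: l => seriesMul f (seriesProd l)

/-- The field `Φ_i[j] = ∂W[j]/∂j_i`; the planar derivative removes a first letter. -/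
def field (W : List E → A) (i : E) : List E → A := fun w => W (i :: w)

/-- The coefficient at the word `w` of the series
`Γ_int[Φ]_i = ∑_m AI_{i y_1 ⋯ y_m} Φ_{y_1}[j] ⋯ Φ_{y_m}[j]`, the planar derivative with respect to
`Φ_i` of `Γ_int = ∑_n AI_{y_1⋯y_n} Φ_{y_1}⋯Φ_{y_n}`.  The fields have no constant term, so
that only the terms with `m ≤ |w|` contribute. -/
def interactionDeriv (AI W : List E → A) (i : E) (w : List E) : A :=
  ∑ m ∈ Finset.range (w.length + 1), ∫ y : Fin m → E,
    AI (i :: List.ofFn y) * seriesProd (List.ofFn fun l => field W (y l)) w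
    ∂(Measure.pi fun _ => μ)

/-- The bare propagator as a function on words: `G_F(i, l)` on the word `i l` of length two, and
zero on all the other words. -/
def bare : List E → A
  | [i, l] => G i l
  | _ => 0

/-- `W` and `AI` are the connected and the amputated 1PI Green's functions of the same theory with
propagator `G`: the planar Legendre relation `∂Γ/∂Φ_i = - j_i` holds at `Φ_i = ∂W/∂j_i`, where
`Γ[Φ] = - Φ G⁻¹ Φ + Γ_int[Φ]`.  With `G` brought to the other side it reads
`Φ_i = G_{il} (j_l + Γ_int[Φ]_l)`, which is written out below for the coefficients at
every word `w`. -/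
def IsPlanarLegendre (AI W : List E → A) : Prop :=
  ∀ (i : E) (w : List E),
    field W i w = bare G (i :: w) + ∫ l, G i l * interactionDeriv μ AI W l w ∂μ

/-- The chain of `p` amputated 1PI two-point functions joined, and terminated at both ends, by
propagators: the kernel of `(G AI⁽²⁾)^p G`. -/
def chain (AI : List E → A) : ℕ → E → E → A
  | 0, i, j => G i j
  | p + 1, i, j => ∫ y : E × E, G i y.1 * AI [y.1, y.2] * chain AI p y.2 j ∂(μ.prod μ)

end Feynman

end PlanarQFT

end

/-! Combinatorics. Each step of the iterated map acts on the monomial of the root and gathers an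
interval of the root's children under a new vertex, which carries the largest label so far. In a
decreasing tree the largest label sits on a child of the root, so every decreasing tree arises in
this way exactly once (`injOn_graft`, `image_graft`) and `iterR` expands into a sum over decreasing
trees (`linearCombination_iterR`). Amplitudes do not see the labels, so dividing by the symmetry
factor leaves every undecorated shape counted once (`sum_inv_symmetryFactor`).

Feynman integrals. By Fubini, the single integral over all internal variables equals the recursive
amplitude `treeAmp`, in which each vertex integrates the amplitude of the forest of its children
(`IsRegular.amplitude_monomials`).

Convergence. With the leaves fixed there are still infinitely many shapes, for two reasons. Subtrees
without leaves contain a tadpole and contribute zero. Chains of vertices with a single child are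
kernels of powers of the self-energy, bounded by the summable constants `c p`. Once the chain at the
bottom of a tree is stripped, the subtrees that contribute have strictly fewer leaves, and induction
on the number of leaves gives absolute convergence in supremum norm
(`IsRegular.tsum_treeSup_ne_top`).

Identification with the connected functions. A tree is a leaf or a vertex with a forest of children,
and the series of forests is a product of series of trees (`IsRegular.hasSum_forestAmp`). Hence the
sum over trees satisfies the planar Legendre relation (`IsRegular.treeSeries_expansion`). The
relation has only one bounded measurable solution: by induction on the length of the word, the
difference of two solutions solves the homogeneous equation `u = G AI⁽²⁾ u`, and iterating it bounds
`u` by a constant times `c p`, which tends to zero (`IsRegular.eq_zero_of_eq_integral`,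
`IsRegular.field_eq_treeSeries`). Grouping the sum by the number of inner vertices gives the
theorem. -/

set_option linter.unusedSectionVars false

noncomputable section

namespace PlanarQFT

/-! ### Operations on forests -/

namespace Forest

variable {L L' J : Type*}

/-- Concatenation of forests. -/
def append : Forest L J → Forest L J → Forest L J
  | nil, g => g
  | leaf j f, g => leaf j (f.append g)
  | node l c f, g => node l c (f.append g)

/-- The first `k` trees of a forest. -/
def take : ℕ → Forest L J → Forest L J
  | 0, _ => nil
  | _ + 1, nil => nil
  | k + 1, leaf j f => leaf j (take k f)
  | k + 1, node l c f => node l c (take k f)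

/-- The forest without its first `k` trees. -/
def drop : ℕ → Forest L J → Forest L J
  | 0, f => f
  | _ + 1, nil => nil
  | k + 1, leaf _ f => drop k f
  | k + 1, node _ _ f => drop k f

/-- The number of trees of a forest. -/
def width : Forest L J → ℕ
  | nil => 0
  | leaf _ f => f.width + 1
  | node _ _ f => f.width + 1

/-- The number of inner vertices. -/
def size : Forest L J → ℕ
  | nil => 0
  | leaf _ f => f.size
  | node _ c f => c.size + f.size + 1

/-- Relabelling of the inner vertices. -/
def relabel (φ : L → L') : Forest L J → Forest L' J
  | nil => nil
  | leaf j f => leaf j (f.relabel φ)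
  | node l c f => node (φ l) (c.relabel φ) (f.relabel φ)

/-- The trees number `a + 1, …, a + m` of the forest become the children of a new vertex `l`. -/
def graft (l : L) : ℕ → ℕ → Forest L J → Forest L J
  | 0, m, f => node l (f.take m) (f.drop m)
  | _ + 1, _, nil => nil
  | a + 1, m, leaf j f => leaf j (graft l a m f)
  | a + 1, m, node i c f => node i c (graft l a m f)

/-- Every inner vertex has at least one child. -/
def Proper : Forest L J → Prop
  | nil => True
  | leaf _ f => f.Proper
  | node _ c f => c ≠ nil ∧ c.Proper ∧ f.Proper

lemma take_append_drop (k : ℕ) (f : Forest L J) : (f.take k).append (f.drop k) = f := by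
  induction k generalizing f with
  | zero => cases f <;> simp [take, drop, append]
  | succ k ih => cases f <;> simp [take, drop, append, ih]

lemma width_take {k : ℕ} {f : Forest L J} (h : k ≤ f.width) : (f.take k).width = k := by
  induction k generalizing f with
  | zero => cases f <;> simp [take, width]
  | succ k ih => cases f <;> simp_all [take, width]

lemma take_width_append (c f : Forest L J) : (c.append f).take c.width = c := by
  induction c with
  | nil => cases f <;> simp [append, take, width]
  | leaf j c ih => simp [append, take, width, ih]
  | node l b c _ ih => simp [append, take, width, ih]

lemma drop_width_append (c f : Forest L J) : (c.append f).drop c.width = f := by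
  induction c with
  | nil => cases f <;> simp [append, drop, width]
  | leaf j c ih => simp [append, drop, width, ih]
  | node l b c _ ih => simp [append, drop, width, ih]

lemma width_append (c f : Forest L J) : (c.append f).width = c.width + f.width := by
  induction c with
  | nil => simp [append, width]
  | leaf j c ih => simp [append, width, ih]; omega
  | node l b c _ ih => simp [append, width, ih]; omega

lemma leaves_append (c f : Forest L J) : (c.append f).leaves = c.leaves ++ f.leaves := by
  induction c with
  | nil => simp [append, leaves]
  | leaf j c ih => simp [append, leaves, ih]
  | node l b c _ ih => simp [append, leaves, ih]

lemma labels_append (c f : Forest L J) : (c.append f).labels = c.labels ++ f.labels := by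
  induction c with
  | nil => simp [append, labels]
  | leaf j c ih => simp [append, labels, ih]
  | node l b c _ ih => simp [append, labels, ih]

lemma decreasing_append [LT L] (c f : Forest L J) :
    (c.append f).Decreasing ↔ c.Decreasing ∧ f.Decreasing := by
  induction c with
  | nil => simp [append, Decreasing]
  | leaf j c ih => simp [append, Decreasing, ih]
  | node l b c _ ih => simp [append, Decreasing, ih, and_assoc]

lemma relabel_append (φ : L → L') (c f : Forest L J) :
    (c.append f).relabel φ = (c.relabel φ).append (f.relabel φ) := by
  induction c with
  | nil => simp [append, relabel]
  | leaf j c ih => simp [append, relabel, ih]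
  | node l b c _ ih => simp [append, relabel, ih]

lemma width_relabel (φ : L → L') (f : Forest L J) : (f.relabel φ).width = f.width := by
  induction f <;> simp_all [relabel, width]

lemma leaves_relabel (φ : L → L') (f : Forest L J) : (f.relabel φ).leaves = f.leaves := by
  induction f <;> simp_all [relabel, leaves]

lemma labels_relabel (φ : L → L') (f : Forest L J) :
    (f.relabel φ).labels = f.labels.map φ := by
  induction f <;> simp_all [relabel, labels]

lemma relabel_eq_nil {φ : L → L'} {f : Forest L J} : f.relabel φ = nil ↔ f = nil := by
  cases f <;> simp [relabel]

lemma relabel_injective {φ : L → L'} (hφ : φ.Injective) :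
    (relabel φ : Forest L J → Forest L' J).Injective := by
  intro f
  induction f with
  | nil => intro g h; cases g <;> simp_all [relabel]
  | leaf j f ih =>
    intro g h
    cases g <;> simp only [relabel, leaf.injEq, reduceCtorEq] at h
    rw [h.1, ih h.2]
  | node l c f ihc ihf =>
    intro g h
    cases g <;> simp only [relabel, node.injEq, reduceCtorEq] at h
    rw [hφ h.1, ihc h.2.1, ihf h.2.2]

lemma decreasing_relabel [LT L] [LT L'] {φ : L → L'} (hφ : ∀ a b, φ a < φ b ↔ a < b)
    (f : Forest L J) : (f.relabel φ).Decreasing ↔ f.Decreasing := by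
  induction f with
  | nil => simp [relabel, Decreasing]
  | leaf j f ih => simp [relabel, Decreasing, ih]
  | node l c f ihc ihf =>
    simp [relabel, Decreasing, ihc, ihf, relabel_eq_nil, labels_relabel, hφ]

lemma exists_relabel_castSucc {n : ℕ} (f : Forest (Fin (n + 1)) J)
    (h : Fin.last n ∉ f.labels) : ∃ g : Forest (Fin n) J, g.relabel Fin.castSucc = f := by
  induction f with
  | nil => exact ⟨nil, rfl⟩
  | leaf j f ih => obtain ⟨g, rfl⟩ := ih h; exact ⟨leaf j g, rfl⟩
  | node l c f ihc ihf =>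
    simp only [labels, List.mem_cons, List.mem_append, not_or] at h
    obtain ⟨g, rfl⟩ := ihc h.2.1
    obtain ⟨g', rfl⟩ := ihf h.2.2
    obtain ⟨i, rfl⟩ := Fin.exists_castSucc_eq.2 (Ne.symm h.1)
    exact ⟨node i g g', rfl⟩

lemma leaves_graft (l : L) {a m : ℕ} {f : Forest L J} (h : a + m ≤ f.width) :
    (graft l a m f).leaves = f.leaves := by
  induction a generalizing f with
  | zero =>
    have : (graft l 0 m f).leaves = ((f.take m).append (f.drop m)).leaves := by
      cases f <;> simp [graft, leaves, leaves_append]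
    rw [this, take_append_drop]
  | succ a ih =>
    cases f with
    | nil => simp [graft]
    | leaf j f => simp [graft, leaves, ih (f := f) (by simp [width] at h; omega)]
    | node i c f => simp [graft, leaves, ih (f := f) (by simp [width] at h; omega)]

lemma labels_graft (l : L) {a m : ℕ} {f : Forest L J} (h : a + m ≤ f.width) :
    (graft l a m f).labels.Perm (l :: f.labels) := by
  induction a generalizing f with
  | zero =>
    have : (graft l 0 m f).labels = l :: ((f.take m).append (f.drop m)).labels := by
      cases f <;> simp [graft, labels, labels_append]
    rw [this, take_append_drop]
  | succ a ih =>
    cases f with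
    | nil => simp [width] at h
    | leaf j f => exact ih (f := f) (by simp [width] at h; omega)
    | node i c f =>
      have := ih (f := f) (by simp [width] at h; omega)
      simp only [graft, labels]
      refine (((this.append_left c.labels).trans List.perm_middle).cons i).trans (.swap ..)

lemma decreasing_graft [LT L] {l : L} {a m : ℕ} {f : Forest L J} (hm : 1 ≤ m)
    (h : a + m ≤ f.width) (hl : ∀ i ∈ f.labels, i < l) (hf : f.Decreasing) :
    (graft l a m f).Decreasing := by
  induction a generalizing f with
  | zero =>
    have e : graft l 0 m f = node l (f.take m) (f.drop m) := by cases f <;> rfl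
    rw [e]
    have hd := hf
    rw [← take_append_drop m f, decreasing_append] at hd
    refine ⟨fun h0 => ?_, fun i hi => hl i ?_, hd.1, hd.2⟩
    · have := width_take (k := m) (f := f) (by omega)
      rw [h0] at this
      simp [width] at this
      omega
    · rw [← take_append_drop m f, labels_append]
      exact List.mem_append_left _ hi
  | succ a ih =>
    cases f with
    | nil => simp [width] at h
    | leaf j f => exact ih (f := f) (by simp [width] at h; omega) hl hf
    | node i c f =>
      refine ⟨hf.1, hf.2.1, hf.2.2.1, ih (f := f) (by simp [width] at h; omega) ?_ hf.2.2.2⟩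
      exact fun i hi => hl i (by simp [labels, hi])

/-- The label `l` is new, so it marks the grafted vertex: its position is `a`, the width of its
children is `m`, and splicing the children back in recovers the forest. -/
lemma graft_injective {l : L} {a m a' m' : ℕ} {f f' : Forest L J}
    (ha : a + m ≤ f.width) (ha' : a' + m' ≤ f'.width)
    (hl : l ∉ f.labels) (hl' : l ∉ f'.labels)
    (h : graft l a m f = graft l a' m' f') : f = f' ∧ a = a' ∧ m = m' := by
  have e (m f) : graft (J := J) l 0 m f = node l (f.take m) (f.drop m) := by cases f <;> rfl
  induction a generalizing f a' f' with
  | zero =>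
    rw [e] at h
    cases a' with
    | zero =>
      rw [e, node.injEq] at h
      have h1 := width_take (k := m) (f := f) (by omega)
      rw [h.2.1, width_take (by omega)] at h1
      subst h1
      refine ⟨?_, rfl, rfl⟩
      rw [← take_append_drop m' f, h.2.1, h.2.2, take_append_drop]
    | succ a' =>
      cases f' with
      | nil => simp [width] at ha'
      | leaf j f' => simp [graft] at h
      | node i c f' => simp only [graft, node.injEq] at h; simp [labels, h.1] at hl'
  | succ a ih =>
    cases f with
    | nil => simp [width] at ha
    | leaf j f =>
      cases a' with
      | zero => rw [e] at h; simp [graft] at h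
      | succ a' =>
        cases f' with
        | nil => simp [width] at ha'
        | leaf j f' =>
          simp only [graft, leaf.injEq] at h
          have := ih (f := f) (f' := f') (a' := a') (by simp [width] at ha; omega)
            (by simp [width] at ha'; omega) hl hl' h.2
          simp [h.1, this]
        | node i c f' => simp [graft] at h
    | node i c f =>
      simp only [labels, List.mem_cons, List.mem_append, not_or] at hl
      cases a' with
      | zero => rw [e] at h; simp only [graft, node.injEq] at h; exact absurd h.1.symm hl.1
      | succ a' =>
        cases f' with
        | nil => simp [width] at ha'
        | leaf j f' => simp [graft] at h
        | node i c f' =>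
          simp only [graft, node.injEq] at h
          simp only [labels, List.mem_cons, List.mem_append, not_or] at hl'
          have := ih (f := f) (f' := f') (a' := a') (by simp [width] at ha; omega)
            (by simp [width] at ha'; omega) hl.2.2 hl'.2.2 h.2.2
          simp [h.1, h.2.1, this]

/-- Nothing lies below the vertex with the largest label, since labels decrease upwards; it is
therefore the bottom of one of the trees. Dissolving it into its children gives `f`, and properness
of the vertex gives `1 ≤ m`. -/
lemma exists_graft {n : ℕ} {g : Forest (Fin (n + 1)) J} (hg : g.Decreasing)
    (hn : g.labels.Nodup) (hl : Fin.last n ∈ g.labels) :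
    ∃ (f : Forest (Fin n) J) (a m : ℕ), 1 ≤ m ∧ a + m ≤ f.width ∧ f.Decreasing ∧
      g = graft (Fin.last n) a m (f.relabel Fin.castSucc) := by
  have e (m f) : graft (J := J) (Fin.last n) 0 m f = node (Fin.last n) (f.take m) (f.drop m) := by
    cases f <;> rfl
  have hlt : ∀ a b : Fin n, a.castSucc < b.castSucc ↔ a < b := fun a b => Iff.rfl
  induction g with
  | nil => simp [labels] at hl
  | leaf j g ih =>
    obtain ⟨f, a, m, hm, ha, hf, rfl⟩ := ih hg hn hl
    exact ⟨leaf j f, a + 1, m, hm, by simp [width]; omega, hf, rfl⟩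
  | node i c g ihc ihg =>
    simp only [labels, List.nodup_cons, List.mem_append, not_or, List.nodup_append] at hn
    obtain ⟨hc, hlab, hcd, hgd⟩ := hg
    have hcl : Fin.last n ∉ c.labels := fun h => absurd (hlab _ h) (Fin.le_last i).not_gt
    by_cases hi : i = Fin.last n
    · subst hi
      obtain ⟨c, rfl⟩ := exists_relabel_castSucc c hcl
      obtain ⟨g, rfl⟩ := exists_relabel_castSucc g hn.1.2
      refine ⟨c.append g, 0, c.width, ?_, by simp [width_append], ?_, ?_⟩
      · cases c <;> simp_all [width, relabel]
      · rw [decreasing_append]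
        exact ⟨(decreasing_relabel hlt c).1 hcd, (decreasing_relabel hlt g).1 hgd⟩
      · rw [e, relabel_append, ← width_relabel Fin.castSucc c, take_width_append,
          drop_width_append]
    · simp only [labels, List.mem_cons, List.mem_append, hcl, false_or, Ne.symm hi] at hl
      obtain ⟨f, a, m, hm, ha, hf, rfl⟩ := ihg hgd hn.2.2.1 hl
      obtain ⟨c, rfl⟩ := exists_relabel_castSucc c hcl
      obtain ⟨i, rfl⟩ := Fin.exists_castSucc_eq.2 hi
      refine ⟨node i c f, a + 1, m, hm, by simp [width]; omega, ?_, rfl⟩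
      refine ⟨by simpa [relabel_eq_nil] using hc, fun k hk => ?_,
        (decreasing_relabel hlt c).1 hcd, hf⟩
      exact hlab k.castSucc (by rw [labels_relabel]; exact List.mem_map_of_mem hk)

variable {n : ℕ}

lemma length_bottom (f : Forest (Fin n) J) : f.bottom.length = f.width := by
  induction f <;> simp_all [bottom, width]

lemma bottom_take (k : ℕ) (f : Forest (Fin n) J) : (f.take k).bottom = f.bottom.take k := by
  induction k generalizing f with
  | zero => cases f <;> simp [take, bottom]
  | succ k ih => cases f <;> simp_all [take, bottom]

lemma bottom_drop (k : ℕ) (f : Forest (Fin n) J) : (f.drop k).bottom = f.bottom.drop k := by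
  induction k generalizing f with
  | zero => cases f <;> simp [drop]
  | succ k ih => cases f <;> simp_all [drop, bottom]

lemma monomials_append (c f : Forest (Fin n) J) :
    (c.append f).monomials = c.monomials ++ f.monomials := by
  induction c with
  | nil => simp [append, monomials]
  | leaf j c ih => simp [append, monomials, ih]
  | node l b c _ ih => simp [append, monomials, ih]

lemma bottom_graft (l : Fin n) {a m : ℕ} {f : Forest (Fin n) J} (h : a ≤ f.width) :
    (graft l a m f).bottom =
      f.bottom.take a ++ Letter.x l :: f.bottom.drop (a + m) := by
  induction a generalizing f with
  | zero => cases f <;> simp [graft, bottom, bottom_drop]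
  | succ a ih =>
    cases f with
    | nil => simp [width] at h
    | leaf j f =>
      simp [graft, bottom, ih (f := f) (by simpa [width] using h), Nat.add_right_comm]
    | node i c f =>
      simp [graft, bottom, ih (f := f) (by simpa [width] using h), Nat.add_right_comm]

/-- Only a permutation, because the monomials of the trees to the left of the new vertex come before
its own. -/
lemma monomials_graft (l : Fin n) {a m : ℕ} {f : Forest (Fin n) J} (h : a ≤ f.width) :
    (graft l a m f).monomials.Perm
      ((Letter.xp l :: (f.bottom.drop a).take m) :: f.monomials) := by
  induction a generalizing f with
  | zero =>
    have e : graft l 0 m f = node l (f.take m) (f.drop m) := by cases f <;> rfl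
    rw [e]
    simp only [monomials, ← monomials_append, take_append_drop, bottom_take, List.drop_zero]
    rfl
  | succ a ih =>
    cases f with
    | nil => simp [width] at h
    | leaf j f => exact ih (f := f) (by simpa [width] using h)
    | node i c f =>
      have := ih (f := f) (by simpa [width] using h)
      simp only [graft, monomials, bottom, List.drop_succ_cons]
      exact (((this.append_left c.monomials).trans List.perm_middle).cons _).trans (.swap ..)

lemma bottom_relabel (f : Forest (Fin n) J) :
    (f.relabel Fin.castSucc).bottom = f.bottom.map Letter.up := by
  induction f <;> simp_all [relabel, bottom, Letter.up]

lemma monomials_relabel (f : Forest (Fin n) J) :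
    (f.relabel Fin.castSucc).monomials = f.monomials.map (List.map Letter.up) := by
  induction f <;> simp_all [relabel, monomials, bottom_relabel, Letter.up]

lemma head_of_mem_monomials {f : Forest (Fin n) J} {a : List (Letter J n)}
    (h : a ∈ f.monomials) : ∃ i ∈ f.labels, ∃ b, a = Letter.xp i :: b := by
  induction f with
  | nil => simp [monomials] at h
  | leaf j f ih => exact ih h
  | node l c f ihc ihf =>
    simp only [monomials, List.mem_cons, List.mem_append] at h
    rcases h with rfl | h | h
    · exact ⟨l, by simp [labels], _, rfl⟩
    · obtain ⟨i, hi, b, rfl⟩ := ihc h; exact ⟨i, by simp [labels, hi], b, rfl⟩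
    · obtain ⟨i, hi, b, rfl⟩ := ihf h; exact ⟨i, by simp [labels, hi], b, rfl⟩

lemma monomials_head_unique {f : Forest (Fin n) J} (hf : f.labels.Nodup) {i : Fin n}
    {a b : List (Letter J n)} (ha : Letter.xp i :: a ∈ f.monomials)
    (hb : Letter.xp i :: b ∈ f.monomials) : a = b := by
  have key : ∀ {g : Forest (Fin n) J} {b}, Letter.xp i :: b ∈ g.monomials → i ∈ g.labels := by
    intro g b h
    obtain ⟨k, hk, c, e⟩ := head_of_mem_monomials h
    simp only [List.cons.injEq, Sum.inr.injEq] at e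
    rwa [e.1]
  induction f with
  | nil => simp [monomials] at ha
  | leaf j f ih => exact ih hf ha hb
  | node l c f ihc ihf =>
    simp only [labels, List.nodup_cons, List.mem_append, not_or, List.nodup_append] at hf
    simp only [monomials, List.mem_cons, List.mem_append, List.cons.injEq, Sum.inr.injEq] at ha hb
    rcases ha with ⟨rfl, rfl⟩ | ha | ha <;> rcases hb with ⟨e, rfl⟩ | hb | hb
    · rfl
    · exact absurd (key hb) hf.1.1
    · exact absurd (key hb) hf.1.2
    · exact absurd (e ▸ key ha) hf.1.1
    · exact ihc hf.2.1 ha hb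
    · exact absurd rfl (hf.2.2.2 _ (key ha) _ (key hb))
    · exact absurd (e ▸ key ha) hf.1.2
    · exact absurd rfl (hf.2.2.2 _ (key hb) _ (key ha))
    · exact ihf hf.2.2.1 ha hb

/-- The bottom word tells leaves from vertices and names the latter; the monomial headed by `x_i'`
is then the bottom word of the children of `x_i`, and the reconstruction recurses. The common
superset `S` lets the uniqueness hypothesis pass to subforests unchanged. -/
lemma eq_of_monomials {S : List (List (Letter J n))}
    (hS : ∀ i a b, Letter.xp i :: a ∈ S → Letter.xp i :: b ∈ S → a = b)
    {f g : Forest (Fin n) J} (hf : f.monomials ⊆ S) (hg : g.monomials ⊆ S)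
    (h : f.bottom = g.bottom) : f = g := by
  induction f generalizing g with
  | nil => cases g <;> simp_all [bottom]
  | leaf j f ih =>
    cases g <;> simp only [bottom, List.cons.injEq, Sum.inl.injEq, reduceCtorEq, false_and] at h
    rename_i j' f'
    rw [h.1, ih (g := f') hf hg h.2]
  | node l c f ihc ihf =>
    cases g <;> simp only [bottom, List.cons.injEq, Sum.inr.injEq, Sum.inl.injEq, reduceCtorEq,
      false_and] at h
    rename_i l' c' f'
    obtain ⟨rfl, h⟩ := h
    simp only [monomials, List.cons_subset, List.append_subset] at hf hg
    rw [ihc hf.2.1 hg.2.1 (hS l _ _ hf.1 hg.1), ihf hf.2.2 hg.2.2 h]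

end Forest

/-- The root monomial is the only one headed by an external letter, so it is recognised in any
rearrangement; `Forest.eq_of_monomials` does the rest. -/
lemma Tree.eq_of_monomials_perm {J : Type*} {n : ℕ} {T T' : Tree (Fin n) J}
    (hT : T.branches.labels.Nodup) (h : T.monomials.Perm T'.monomials) : T = T' := by
  obtain ⟨r, f⟩ := T
  obtain ⟨r', f'⟩ := T'
  simp only [Tree.monomials] at h hT
  have h1 : Letter.ext r' :: f'.bottom ∈ (Letter.ext r :: f.bottom) :: f.monomials :=
    h.mem_iff.2 (by simp)
  have h2 : Letter.ext r' :: f'.bottom = (Letter.ext r :: f.bottom) := by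
    rcases List.mem_cons.1 h1 with h1 | h1
    · exact h1
    · obtain ⟨i, -, b, hb⟩ := Forest.head_of_mem_monomials h1
      simp at hb
  rw [h2] at h
  simp only [List.cons.injEq, Sum.inl.injEq] at h2
  have h3 := (List.perm_cons _).1 h
  obtain ⟨rfl, h4⟩ := h2
  rw [Forest.eq_of_monomials (S := f.monomials)
    (fun i a b => Forest.monomials_head_unique hT) (List.Subset.refl _) h3.symm.subset h4.symm]

lemma Tree.IsDecreasing.nodup_labels {J : Type*} {n : ℕ} {T : Tree (Fin n) J}
    (hT : T.IsDecreasing) : T.branches.labels.Nodup :=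
  hT.2.nodup_iff.2 (List.nodup_finRange n)

/-- The existential in the symmetry factor of a tensor product has a single witness, by
`Tree.eq_of_monomials_perm`. -/
lemma symmetryFactor_monomials {J : Type*} {n : ℕ} {T : Tree (Fin n) J} (hT : T.IsDecreasing) :
    PlanarQFT.symmetryFactor T.monomials = T.symmetryFactor := by
  unfold PlanarQFT.symmetryFactor Tree.symmetryFactor
  congr 1
  ext T'
  refine and_congr_right fun _ => ⟨?_, fun h => ⟨T, hT, .refl _, h⟩⟩
  rintro ⟨T₁, h₁, hp, he⟩
  rw [he, Tree.eq_of_monomials_perm h₁.nodup_labels hp]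

lemma symmetryFactor_perm {J : Type*} {n : ℕ} {O O' : List (List (Letter J n))}
    (h : O.Perm O') : symmetryFactor O = symmetryFactor O' := by
  unfold symmetryFactor
  congr 1
  ext T'
  refine and_congr_right fun _ => exists_congr fun T => and_congr_right fun _ =>
    and_congr_left fun _ => ⟨fun h' => h'.trans h, fun h' => h'.trans h.symm⟩

/-! ### The iterated map as a sum over decreasing trees -/

section IterR

variable {J : Type*}

/-- The tree obtained by giving the children number `p, …, q - 1` of the root to a new child of
the root, decorated by `x_{n+1}`. -/
def Tree.graft {n : ℕ} (T : Tree (Fin n) J) (p q : ℕ) : Tree (Fin (n + 1)) J :=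
  ⟨T.root, .graft (Fin.last n) (p - 1) (q - p) (T.branches.relabel Fin.castSucc)⟩

/-- The triples of a decreasing tree and of the ends of an interval of children of its root. -/
def graftData (n : ℕ) (j : J) (w : List J) : Set (Tree (Fin n) J × ℕ × ℕ) :=
  {x | x.1 ∈ decreasingTrees n j w ∧ 1 ≤ x.2.1 ∧ x.2.1 + 1 ≤ x.2.2 ∧
    x.2.2 ≤ x.1.branches.width + 1}

lemma last_notMem_labels {n : ℕ} (f : Forest (Fin n) J) :
    Fin.last n ∉ (f.relabel Fin.castSucc).labels := by
  simp [Forest.labels_relabel]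

lemma injOn_graft (n : ℕ) (j : J) (w : List J) :
    Set.InjOn (fun x : Tree (Fin n) J × ℕ × ℕ => x.1.graft x.2.1 x.2.2) (graftData n j w) := by
  rintro ⟨⟨r, f⟩, p, q⟩ ⟨⟨h1, h2, h3⟩, h4, h5, h6⟩ ⟨⟨r', f'⟩, p', q'⟩
    ⟨⟨h1', h2', h3'⟩, h4', h5', h6'⟩ h
  simp only [Tree.graft, Tree.mk.injEq] at *
  obtain ⟨h7, h8, h9⟩ := Forest.graft_injective (by rw [Forest.width_relabel]; omega)
    (by rw [Forest.width_relabel]; omega) (last_notMem_labels f) (last_notMem_labels f') h.2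
  have := Forest.relabel_injective (Fin.castSucc_injective n) h7
  simp only [Prod.mk.injEq, Tree.mk.injEq]
  exact ⟨⟨h.1, this⟩, by omega, by omega⟩

lemma finRange_perm (n : ℕ) :
    (List.finRange (n + 1)).Perm (Fin.last n :: (List.finRange n).map Fin.castSucc) := by
  rw [List.finRange_succ_last]
  exact List.perm_append_singleton _ _

/-- Grafting with the largest label preserves decrease and leaves; conversely `Forest.exists_graft`
removes the vertex with the largest label. Together with `injOn_graft` this is the recursion behind
the count of decreasing trees. -/
lemma image_graft (n : ℕ) (j : J) (w : List J) :
    (fun x : Tree (Fin n) J × ℕ × ℕ => x.1.graft x.2.1 x.2.2) '' graftData n j w =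
      decreasingTrees (n + 1) j w := by
  have hlt : ∀ a b : Fin n, a.castSucc < b.castSucc ↔ a < b := fun a b => Iff.rfl
  ext ⟨r, g⟩
  constructor
  · rintro ⟨⟨⟨r, f⟩, p, q⟩, ⟨⟨⟨h1, h2⟩, h3, h4⟩, h5, h6, h7⟩, h⟩
    simp only [Tree.graft, Tree.mk.injEq] at *
    obtain ⟨rfl, rfl⟩ := h
    have hw : p - 1 + (q - p) ≤ (f.relabel Fin.castSucc).width := by
      rw [Forest.width_relabel]; omega
    refine ⟨⟨Forest.decreasing_graft (by omega) hw ?_ ((Forest.decreasing_relabel hlt f).2 h1),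
      ?_⟩, h3, ?_⟩
    · intro i hi
      exact lt_of_le_of_ne (Fin.le_last i) fun h => last_notMem_labels f (h ▸ hi)
    · refine (Forest.labels_graft _ hw).trans (.trans ?_ (finRange_perm n).symm)
      rw [Forest.labels_relabel]
      exact (h2.map _).cons _
    · exact (Forest.leaves_graft _ hw).trans ((Forest.leaves_relabel _ _).trans h4)
  · rintro ⟨⟨h1, h2⟩, h3, h4⟩
    simp only at h1 h2 h3 h4
    obtain ⟨f, a, m, hm, ha, hf, rfl⟩ := Forest.exists_graft h1
      (h2.nodup_iff.2 (List.nodup_finRange _)) (h2.mem_iff.2 (List.mem_finRange _))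
    have ha' := ha
    rw [← Forest.width_relabel Fin.castSucc] at ha'
    refine ⟨(⟨r, f⟩, a + 1, a + 1 + m), ⟨⟨⟨hf, ?_⟩, h3, ?_⟩, ?_, ?_, ?_⟩, ?_⟩
    · have := ((Forest.labels_graft _ ha').symm.trans h2).trans (finRange_perm n)
      rw [List.perm_cons, Forest.labels_relabel] at this
      exact (List.map_perm_map_iff (Fin.castSucc_injective n)).1 this
    · rwa [Forest.leaves_graft _ ha', Forest.leaves_relabel] at h4
    · simp
    · simp; omega
    · simp; omega
    · simp [Tree.graft]

/-- With no labels available a forest is just its word of leaves. -/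
lemma decreasingTrees_zero (j : J) (w : List J) :
    ∃ f : Forest (Fin 0) J, decreasingTrees 0 j w = {⟨j, f⟩} ∧
      f.bottom = w.map Letter.ext ∧ f.monomials = [] := by
  have key : ∃ f : Forest (Fin 0) J, f.leaves = w ∧ f.labels = [] ∧ f.Decreasing ∧
      f.bottom = w.map Letter.ext ∧ f.monomials = [] ∧ ∀ g : Forest (Fin 0) J,
      g.leaves = w → g = f := by
    induction w with
    | nil =>
      refine ⟨.nil, rfl, rfl, trivial, rfl, rfl, fun g hg => ?_⟩
      cases g with
      | nil => rfl
      | leaf j f => simp [Forest.leaves] at hg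
      | node l => exact l.elim0
    | cons j w ih =>
      obtain ⟨f, h1, h2, h3, h4, h5, h6⟩ := ih
      refine ⟨.leaf j f, by simp [Forest.leaves, h1], h2, h3, by simp [Forest.bottom, h4], h5,
        fun g hg => ?_⟩
      cases g with
      | nil => simp [Forest.leaves] at hg
      | leaf j f =>
        simp only [Forest.leaves, List.cons.injEq] at hg
        rw [hg.1, h6 f hg.2]
      | node l => exact l.elim0
  obtain ⟨f, h1, h2, h3, h4, h5, h6⟩ := key
  refine ⟨f, ?_, h4, h5⟩
  ext ⟨r, g⟩
  constructor
  · rintro ⟨-, rfl, h⟩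
    rw [h6 g h]; rfl
  · rintro ⟨rfl, rfl⟩
    exact ⟨⟨h3, by simp [h2]⟩, rfl, h1⟩

lemma finite_graftData {n : ℕ} {j : J} {w : List J} (h : (decreasingTrees n j w).Finite) :
    (graftData n j w).Finite := by
  have : graftData n j w ⊆ ⋃ T ∈ decreasingTrees n j w,
      (fun y : ℕ × ℕ => (T, y)) '' (Set.Iic (T.branches.width + 1) ×ˢ
        Set.Iic (T.branches.width + 1)) := by
    rintro ⟨T, p, q⟩ ⟨h1, h2, h3, h4⟩
    simp only [Set.mem_iUnion]
    simp only at h2 h3 h4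
    exact ⟨T, h1, (p, q), ⟨by simp; omega, by simp; omega⟩, rfl⟩
  refine Set.Finite.subset (h.biUnion fun T _ => Set.Finite.image _ ?_) this
  exact (Set.finite_Iic _).prod (Set.finite_Iic _)

lemma finite_decreasingTrees (n : ℕ) (j : J) (w : List J) :
    (decreasingTrees n j w).Finite := by
  induction n with
  | zero => obtain ⟨f, h, -⟩ := decreasingTrees_zero j w; simp [h]
  | succ n ih => rw [← image_graft]; exact (finite_graftData ih).image _

variable {M : Type*} [AddCommGroup M] [Module ℝ M]

/-- Cutting the root monomial into three intervals is choosing an interval of children to graft.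
Insensitivity of `φ` to the order of the tail is needed because the step puts the new monomial in
second place, while the grafted tree lists it where its vertex stands. -/
lemma linearCombination_stepOnTensor {n : ℕ} {φ : List (List (Letter J (n + 1))) → M}
    (hφ : ∀ a O O', O.Perm O' → φ (a :: O) = φ (a :: O')) (T : Tree (Fin n) J) :
    Finsupp.linearCombination ℝ φ (stepOnTensor T.monomials) =
      ∑ p ∈ Finset.Icc 1 (T.branches.width + 1), ∑ q ∈ Finset.Icc (p + 1) (T.branches.width + 1),
        φ (T.graft p q).monomials := by
  obtain ⟨r, f⟩ := T
  simp only [Tree.monomials, stepOnTensor, map_sum, Finsupp.linearCombination_single, one_smul,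
    List.length_cons, Forest.length_bottom]
  refine Finset.sum_congr rfl fun p hp => Finset.sum_congr rfl fun q hq => ?_
  rw [Finset.mem_Icc] at hp hq
  -- `p` and `q` count letters of the root monomial, which begins with the decoration of the root;
  -- the positions among the branches are one less.
  obtain ⟨a, rfl⟩ : ∃ a, p = a + 1 := ⟨p - 1, by omega⟩
  obtain ⟨b, rfl⟩ : ∃ b, q = b + 1 := ⟨q - 1, by omega⟩
  have hw : a ≤ (f.relabel Fin.castSucc).width := by rw [Forest.width_relabel]; omega
  have e : a + (b - a) = b := by omega
  simp only [Tree.graft, Nat.add_sub_cancel, Nat.add_sub_add_right, Forest.bottom_graft _ hw,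
    Forest.bottom_relabel, e]
  rw [hφ _ _ _ (Forest.monomials_graft _ hw)]
  simp [Letter.up, Forest.bottom_relabel, Forest.monomials_relabel, List.map_take, List.map_drop]

/-- The last step is absorbed into the functional, so the induction hypothesis applies to a new `φ`;
the resulting double sum over trees and intervals is reindexed by grafting. -/
lemma linearCombination_iterR (n : ℕ) {φ : List (List (Letter J n)) → M}
    (hφ : ∀ a O O', O.Perm O' → φ (a :: O) = φ (a :: O')) (j : J) (w : List J) :
    Finsupp.linearCombination ℝ φ (iterR J n (word (j :: w))) =
      ∑ᶠ T ∈ decreasingTrees n j w, φ T.monomials := by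
  induction n with
  | zero =>
    obtain ⟨f, h, h1, h2⟩ := decreasingTrees_zero j w
    rw [h, finsum_mem_singleton]
    simp [iterR, Tree.monomials, h1, h2, word]
  | succ n ih =>
    have e : Finsupp.linearCombination ℝ φ (iterR J (n + 1) (word (j :: w))) =
        Finsupp.linearCombination ℝ (fun O => Finsupp.linearCombination ℝ φ (stepOnTensor O))
          (iterR J n (word (j :: w))) := by
      simp only [iterR, LinearMap.comp_apply, step]
      generalize iterR J n (word (j :: w)) = x
      induction x using Finsupp.induction_linear with
      | zero => simp
      | add f g hf hg => simp [hf, hg]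
      | single a b => simp
    rw [e, ih, ← image_graft, finsum_mem_image (injOn_graft n j w)]
    · simp_rw [linearCombination_stepOnTensor hφ]
      have hfin := finite_decreasingTrees n j w
      rw [finsum_mem_eq_finite_toFinset_sum _ hfin,
        finsum_mem_eq_finite_toFinset_sum _ (finite_graftData hfin)]
      simp_rw [Finset.sum_sigma']
      refine Finset.sum_nbij' (fun x => (x.1, x.2.1, x.2.2)) (fun x => ⟨x.1, x.2.1, x.2.2⟩)
        ?_ ?_ ?_ ?_ ?_
      · rintro ⟨T, p, q⟩ h
        simp only [Finset.mem_sigma, Finset.mem_Icc, Set.Finite.mem_toFinset] at h ⊢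
        exact ⟨h.1, h.2.1.1, h.2.2.1, h.2.2.2⟩
      · rintro ⟨T, p, q⟩ h
        simp only [Finset.mem_sigma, Finset.mem_Icc, Set.Finite.mem_toFinset] at h ⊢
        obtain ⟨h1, h2, h3, h4⟩ := h
        simp only at *
        exact ⟨h1, ⟨h2, by omega⟩, h3, h4⟩
      · rintro ⟨T, p, q⟩ h; rfl
      · rintro ⟨T, p, q⟩ h; rfl
      · rintro ⟨T, p, q⟩ h; rfl
    -- The absorbed functional is again insensitive to the order of the tail, as the step only cuts
    -- the first factor.
    · intro a O O' h
      have hup := h.map (List.map (Letter.up (J := J)))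
      simp only [stepOnTensor, map_sum, Finsupp.linearCombination_single, one_smul]
      exact Finset.sum_congr rfl fun p _ => Finset.sum_congr rfl fun q _ =>
        hφ _ _ _ (hup.cons _)

end IterR

/-! ### Decreasing labellings of a shape -/

namespace Forest

variable {J : Type*}

/-- The labelling of the inner vertices by `k, k + 1, …` in postorder. -/
def postorder {n : ℕ} : (f : Forest Unit J) → (k : ℕ) → k + f.size ≤ n → Forest (Fin n) J
  | nil, _, _ => nil
  | leaf j f, k, h => leaf j (f.postorder k h)
  | node _ c f, k, h =>
    node ⟨k + c.size, by simp only [size] at h; omega⟩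
      (c.postorder k (by simp only [size] at h; omega))
      (f.postorder (k + c.size + 1) (by simp only [size] at h; omega))

lemma labels_postorder {n : ℕ} (f : Forest Unit J) (k : ℕ) (h : k + f.size ≤ n) :
    ((f.postorder k h).labels.map Fin.val).Perm (List.range' k f.size) := by
  induction f generalizing k with
  | nil => simp [postorder, labels, size]
  | leaf j f ih => exact ih k h
  | node l c f ihc ihf =>
    simp only [postorder, labels, List.map_cons, List.map_append, size]
    have e : List.range' k (c.size + f.size + 1) =
        List.range' k c.size ++ (k + c.size) :: List.range' (k + c.size + 1) f.size := by
      rw [← List.range'_succ, show c.size + f.size + 1 = c.size + (f.size + 1) by ring,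
        ← List.range'_append_1]
    rw [e]
    refine List.Perm.trans ?_ List.perm_middle.symm
    exact ((ihc _ _).append (ihf _ _)).cons _

lemma erase_postorder {n : ℕ} (f : Forest Unit J) (k : ℕ) (h : k + f.size ≤ n) :
    (f.postorder k h).erase = f := by
  induction f generalizing k with
  | nil => rfl
  | leaf j f ih => simp only [postorder, erase, ih k h]
  | node l c f ihc ihf => simp [postorder, erase, ihc, ihf]

/-- In postorder a vertex is numbered after all its descendants. -/
lemma decreasing_postorder {n : ℕ} {f : Forest Unit J} (hf : f.Proper) (k : ℕ)
    (h : k + f.size ≤ n) : (f.postorder k h).Decreasing := by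
  induction f generalizing k with
  | nil => trivial
  | leaf j f ih => exact ih hf k h
  | node l c f ihc ihf =>
    refine ⟨?_, fun m hm => ?_, ihc hf.2.1 _ _, ihf hf.2.2 _ _⟩
    · have := hf.1
      cases c <;> simp_all [postorder]
    · have := (labels_postorder c k (by simp only [size] at h; omega)).subset
        (List.mem_map_of_mem hm)
      rw [List.mem_range'_1] at this
      exact Fin.lt_def.2 this.2

lemma size_eq_length_labels {L : Type*} (f : Forest L J) : f.size = f.labels.length := by
  induction f <;> simp_all [size, labels]

lemma size_erase {L : Type*} (f : Forest L J) : f.erase.size = f.size := by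
  induction f <;> simp_all [size, erase]

lemma leaves_erase {L : Type*} (f : Forest L J) : f.erase.leaves = f.leaves := by
  induction f <;> simp_all [leaves, erase]

lemma width_erase {L : Type*} (f : Forest L J) : f.erase.width = f.width := by
  induction f <;> simp_all [width, erase]

lemma Decreasing.proper_erase {L : Type*} [LT L] {f : Forest L J} (hf : f.Decreasing) :
    f.erase.Proper := by
  induction f with
  | nil => trivial
  | leaf j f ih => exact ih hf
  | node l c f ihc ihf =>
    refine ⟨?_, ihc hf.2.2.1, ihf hf.2.2.2⟩
    have := hf.1
    cases c <;> simp_all [erase]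

end Forest

/-- The postorder labelling shows that every proper shape carries a decreasing decoration, so no
shape is missing from the sum over decreasing trees. -/
lemma image_erase_decreasingTrees {J : Type*} (n : ℕ) (j : J) (w : List J) :
    (fun T : Tree (Fin n) J => T.branches.erase) '' decreasingTrees n j w =
      {f | f.Proper ∧ f.leaves = w ∧ f.size = n} := by
  ext f
  constructor
  · rintro ⟨T, ⟨h1, h2, h3⟩, rfl⟩
    refine ⟨h1.1.proper_erase, (Forest.leaves_erase _).trans h3, ?_⟩
    rw [Forest.size_erase, Forest.size_eq_length_labels, h1.2.length_eq, List.length_finRange]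
  · rintro ⟨h1, rfl, rfl⟩
    refine ⟨⟨j, f.postorder 0 (by simp)⟩, ⟨⟨Forest.decreasing_postorder h1 _ _, ?_⟩, rfl, ?_⟩,
      Forest.erase_postorder _ _ _⟩
    · rw [← List.map_perm_map_iff Fin.val_injective]
      refine (Forest.labels_postorder f 0 (by simp)).trans ?_
      rw [List.range'_eq_map_range]
      simp [List.map_id']
    · rw [← Forest.leaves_erase, Forest.erase_postorder]

/-- Division by the symmetry factor counts every shape once. -/
lemma sum_inv_symmetryFactor {J M : Type*} [AddCommGroup M] [Module ℝ M] (n : ℕ) (j : J)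
    (w : List J) (a : Forest Unit J → M) :
    ∑ᶠ T ∈ decreasingTrees n j w, (T.symmetryFactor : ℝ)⁻¹ • a T.branches.erase =
      ∑ᶠ f ∈ {f : Forest Unit J | f.Proper ∧ f.leaves = w ∧ f.size = n}, a f := by
  classical
  have hfin := finite_decreasingTrees n j w
  have hfin' := hfin.image (fun T : Tree (Fin n) J => T.branches.erase)
  rw [← image_erase_decreasingTrees n j w, finsum_mem_eq_finite_toFinset_sum _ hfin,
    finsum_mem_eq_finite_toFinset_sum _ hfin',
    ← Finset.sum_fiberwise_of_maps_to (t := hfin'.toFinset) (g := fun T => T.branches.erase)]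
  · refine Finset.sum_congr rfl fun f hf => ?_
    -- The shape fixes the leaves, so the decorations counted by the symmetry factor form exactly
    -- the fibre over `f`: each member is weighted by the inverse of the size of the fibre.
    have key : ∀ T ∈ hfin.toFinset.filter (fun T => T.branches.erase = f),
        T.symmetryFactor = (hfin.toFinset.filter (fun T => T.branches.erase = f)).card := by
      intro T hT
      simp only [Finset.mem_filter, Set.Finite.mem_toFinset] at hT
      rw [Tree.symmetryFactor, ← Set.ncard_coe_finset]
      congr 1
      ext T'
      simp only [Finset.coe_filter, Set.Finite.mem_toFinset, Set.mem_ofPred_eq]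
      obtain ⟨⟨h1, h2, h3⟩, rfl⟩ := hT
      obtain ⟨r, g⟩ := T
      obtain ⟨r', g'⟩ := T'
      simp only [Tree.erase, Tree.mk.injEq, decreasingTrees, Set.mem_ofPred_eq] at *
      constructor
      · rintro ⟨h4, h5, h6⟩
        refine ⟨⟨h4, h5.trans h2, ?_⟩, h6⟩
        rw [← Forest.leaves_erase, h6, Forest.leaves_erase, h3]
      · rintro ⟨⟨h4, h5, h6⟩, h7⟩
        exact ⟨h4, h5.trans h2.symm, h7⟩
    rw [Finset.sum_congr rfl (fun T hT => by
      rw [key T hT, (Finset.mem_filter.1 hT).2]), Finset.sum_const, ← Nat.cast_smul_eq_nsmul ℝ,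
      smul_smul, mul_inv_cancel₀, one_smul]
    rw [Nat.cast_ne_zero, Finset.card_ne_zero]
    simp only [Set.Finite.mem_toFinset, Set.mem_image] at hf
    obtain ⟨T, hT, h⟩ := hf
    exact ⟨T, by simp [hT, h]⟩
  · intro T hT
    simp only [Set.Finite.mem_toFinset] at hT ⊢
    exact Set.mem_image_of_mem _ hT

/-! ### The Feynman rule on the iterated map -/

section

variable {E A : Type*} [MeasurableSpace E] (μ : Measure E)
  [NormedCommRing A] [NormedAlgebra ℝ A] (G : E → E → A)

lemma amplitude_perm (AI : List E → A) {n : ℕ} {O O' : List (List (Letter E n))}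
    (h : O.Perm O') : amplitude μ G AI O = amplitude μ G AI O' := by
  unfold amplitude
  congr 1
  ext z
  rw [(h.map _).prod_eq]

lemma feynmanRule_iterR (AI : List E → A) (n : ℕ) (j : E) (w : List E) :
    feynmanRule μ G AI n (iterR E n (word (j :: w))) =
      ∑ᶠ T ∈ decreasingTrees n j w,
        (T.symmetryFactor : ℝ)⁻¹ • amplitude μ G AI T.monomials := by
  rw [feynmanRule, linearCombination_iterR]
  · refine finsum_mem_congr rfl fun T hT => ?_
    rw [symmetryFactor_monomials hT.1]
  · intro a O O' h
    rw [symmetryFactor_perm (h.cons a), amplitude_perm μ G AI (h.cons a)]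

end

/-! ### Recursive amplitudes of trees and forests -/

section Recursive

universe u

variable {E : Type u} {A L L' : Type*} [MeasurableSpace E] (μ : Measure E)
  [NormedCommRing A] [NormedAlgebra ℝ A] (G : E → E → A) (AI : List E → A)

/-- The amplitude of a forest whose trees are attached to the points of a list: the bare
propagator for a leaf, and for an inner vertex with children `c` the propagator to that vertex,
integrated against its amputated function and the amplitude of `c`. -/
def forestAmp : Forest L E → List E → A
  | .nil, [] => 1
  | .nil, _ :: _ => 0
  | .leaf _ _, [] => 0
  | .leaf j f, y :: ys => G y j * forestAmp f ys
  | .node _ _ _, [] => 0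
  | .node _ c f, y :: ys =>
    (∫ l, G y l * ∫ v : Fin c.width → E, AI (l :: List.ofFn v) * forestAmp c (List.ofFn v)
      ∂(Measure.pi fun _ => μ) ∂μ) * forestAmp f ys

/-- The amplitude of a vertex together with everything above it, amputated at the root. -/
def vertexAmp (c : Forest L E) (l : E) : A :=
  ∫ v : Fin c.width → E, AI (l :: List.ofFn v) * forestAmp μ G AI c (List.ofFn v)
    ∂(Measure.pi fun _ => μ)

/-- The amplitude of a tree with at least one vertex, the root being attached to `y`. -/
def treeAmp (c : Forest L E) (y : E) : A := ∫ l, G y l * vertexAmp μ G AI c l ∂μ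

lemma forestAmp_node (i : L) (c f : Forest L E) (y : E) (ys : List E) :
    forestAmp μ G AI (.node i c f) (y :: ys) = treeAmp μ G AI c y * forestAmp μ G AI f ys := rfl

lemma integral_ofFn_congr {m n : ℕ} (h : m = n) (F : List E → A) :
    ∫ v : Fin m → E, F (List.ofFn v) ∂(Measure.pi fun _ => μ) =
      ∫ v : Fin n → E, F (List.ofFn v) ∂(Measure.pi fun _ => μ) := by
  subst h; rfl

/-- Labels never enter the recursion. The widths of the two child forests agree only
propositionally, so the domain of integration is transported by `integral_ofFn_congr`. -/
lemma forestAmp_congr_erase (f : Forest L E) (g : Forest L' E) (h : f.erase = g.erase) :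
    forestAmp μ G AI f = forestAmp μ G AI g := by
  induction f generalizing g with
  | nil =>
    cases g <;> simp only [Forest.erase, reduceCtorEq] at h
    funext ys
    cases ys <;> rfl
  | leaf j f ih =>
    cases g <;> simp only [Forest.erase, reduceCtorEq, Forest.leaf.injEq] at h
    obtain ⟨rfl, h⟩ := h
    funext ys
    cases ys with
    | nil => rfl
    | cons y ys => simp only [forestAmp, ih _ h]
  | node i c f ihc ihf =>
    cases g <;> simp only [Forest.erase, reduceCtorEq, Forest.node.injEq, true_and] at h
    rename_i i' c' f'
    funext ys
    cases ys with
    | nil => rfl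
    | cons y ys =>
      have hw : c.width = c'.width := by rw [← Forest.width_erase, h.1, Forest.width_erase]
      simp only [forestAmp, ihf _ h.2, ihc _ h.1]
      congr! 4 with l
      exact integral_ofFn_congr μ hw fun v => AI (l :: v) * forestAmp μ G AI c' v

lemma treeAmp_erase (f : Forest L E) : treeAmp μ G AI f.erase = treeAmp μ G AI f := by
  have he : f.erase.erase = f.erase := by
    induction f <;> simp_all [Forest.erase]
  funext y
  simp only [treeAmp, vertexAmp, forestAmp_congr_erase μ G AI _ _ he]
  congr! 3 with l
  exact integral_ofFn_congr μ f.width_erase fun v => AI (l :: v) * forestAmp μ G AI f v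

/-- The standing assumptions on the propagator and on the amputated functions. -/
structure IsRegular : Prop where
  symm : ∀ x y, G x y = G y x
  meas : StronglyMeasurable (Function.uncurry G)
  bdd : ∃ C : ℝ, ∀ x y, ‖G x y‖ ≤ C
  int : ∀ n, Integrable (fun v : Fin n → E => AI (List.ofFn v)) (Measure.pi fun _ => μ)

end Recursive

/-! ### Splitting off the first coordinate of a product integral, with parameters -/

section Cons

variable {E A Θ : Type*} [MeasurableSpace E] (μ : Measure E) [SigmaFinite μ]
  [NormedAddCommGroup A] [MeasurableSpace Θ] {ν : Measure Θ} [SFinite ν]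

/-- Adding a first coordinate. -/
def consEquiv (E : Type*) [MeasurableSpace E] (n : ℕ) :
    E × (Fin n → E) ≃ᵐ (Fin (n + 1) → E) :=
  (MeasurableEquiv.piFinSuccAbove (fun _ => E) 0).symm

lemma ofFn_consEquiv {n : ℕ} (p : E × (Fin n → E)) :
    List.ofFn (consEquiv E n p) = p.1 :: List.ofFn p.2 := by
  rw [← List.ofFn_cons]
  congr 1
  simp [consEquiv, MeasurableEquiv.piFinSuccAbove, Fin.insertNthEquiv]

lemma measurePreserving_consEquiv (n : ℕ) :
    MeasurePreserving (consEquiv E n) (μ.prod (Measure.pi fun _ => μ)) (Measure.pi fun _ => μ) :=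
  (measurePreserving_piFinSuccAbove (fun _ => μ) 0).symm

lemma integral_ofFn_succ [NormedSpace ℝ A] {n : ℕ} (h : List E → A) :
    ∫ v : Fin (n + 1) → E, h (List.ofFn v) ∂(Measure.pi fun _ => μ) =
      ∫ p : E × (Fin n → E), h (p.1 :: List.ofFn p.2) ∂(μ.prod (Measure.pi fun _ => μ)) := by
  rw [← (measurePreserving_consEquiv μ n).integral_comp']
  simp_rw [ofFn_consEquiv]

lemma integrable_ofFn_succ {n : ℕ} {h : List E → A}
    (hh : Integrable (fun v : Fin (n + 1) → E => h (List.ofFn v)) (Measure.pi fun _ => μ)) :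
    Integrable (fun p : E × (Fin n → E) => h (p.1 :: List.ofFn p.2))
      (μ.prod (Measure.pi fun _ => μ)) := by
  simpa only [Function.comp_def, ofFn_consEquiv] using
    ((measurePreserving_consEquiv μ n).integrable_comp_emb (consEquiv E n).measurableEmbedding).2 hh

lemma measurePreserving_cons_param (n : ℕ) :
    MeasurePreserving (fun q : (Θ × E) × (Fin n → E) => (q.1.1, consEquiv E n (q.1.2, q.2)))
      ((ν.prod μ).prod (Measure.pi fun _ => μ)) (ν.prod (Measure.pi fun _ => μ)) :=
  ((MeasurePreserving.id ν).prod (measurePreserving_consEquiv μ n)).comp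
    (measurePreserving_prodAssoc ν μ (Measure.pi fun _ => μ))

lemma aestronglyMeasurable_cons_param {n : ℕ} {h : Θ → List E → A}
    (hh : AEStronglyMeasurable (fun q : Θ × (Fin (n + 1) → E) => h q.1 (List.ofFn q.2))
      (ν.prod (Measure.pi fun _ => μ))) :
    AEStronglyMeasurable (fun q : (Θ × E) × (Fin n → E) => h q.1.1 (q.1.2 :: List.ofFn q.2))
      ((ν.prod μ).prod (Measure.pi fun _ => μ)) := by
  simpa only [Function.comp_def, ofFn_consEquiv] using
    hh.comp_measurePreserving (measurePreserving_cons_param μ n)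

lemma integrable_cons_param {n : ℕ} {h : Θ → List E → A}
    (hh : Integrable (fun q : Θ × (Fin (n + 1) → E) => h q.1 (List.ofFn q.2))
      (ν.prod (Measure.pi fun _ => μ))) :
    Integrable (fun q : (Θ × E) × (Fin n → E) => h q.1.1 (q.1.2 :: List.ofFn q.2))
      ((ν.prod μ).prod (Measure.pi fun _ => μ)) := by
  simpa only [Function.comp_def, ofFn_consEquiv] using
    (measurePreserving_cons_param μ n).integrable_comp_of_integrable hh

lemma measurePreserving_rotate {F : Type*} [MeasurableSpace F] (ζ : Measure F) [SFinite ζ] :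
    MeasurePreserving (fun q : (Θ × F) × E => ((q.1.1, q.2), q.1.2))
      ((ν.prod ζ).prod μ) ((ν.prod μ).prod ζ) := by
  have h1 := measurePreserving_prodAssoc ν ζ μ
  have h2 := (MeasurePreserving.id ν).prod (Measure.measurePreserving_swap (μ := ζ) (ν := μ))
  have h3 := (measurePreserving_prodAssoc ν μ ζ).symm
  exact h3.comp (h2.comp h1)

lemma measurePreserving_split {F K : Type*} [MeasurableSpace F] [MeasurableSpace K]
    (ζ : Measure F) [SFinite ζ] (κ : Measure K) [SFinite κ] :
    MeasurePreserving (fun q : Θ × ((E × F) × K) => (((q.1, q.2.1.1), q.2.1.2), q.2.2))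
      (ν.prod ((μ.prod ζ).prod κ)) (((ν.prod μ).prod ζ).prod κ) := by
  have h1 := (measurePreserving_prodAssoc ν (μ.prod ζ) κ).symm
  have h2 := ((measurePreserving_prodAssoc ν μ ζ).symm).prod (MeasurePreserving.id κ)
  exact h2.comp h1

end Cons

/-! ### Measurability and boundedness of recursive amplitudes -/

section Regularity

universe u

variable {E : Type u} {A L : Type*} [MeasurableSpace E] {μ : Measure E} [SigmaFinite μ]
  [NormedCommRing A] [NormedAlgebra ℝ A] {G : E → E → A} {AI : List E → A}

/-- For every fixed `y` the integral sees only the almost-everywhere class of `g`, so a measurable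
representative may replace it and the result is measurable everywhere. -/
lemma stronglyMeasurable_integral_mul {X Y : Type*} [MeasurableSpace X] [MeasurableSpace Y]
    {μ : Measure Y} [SFinite μ] {H : X → Y → A} (hH : StronglyMeasurable (Function.uncurry H))
    {g : Y → A} (hg : AEStronglyMeasurable g μ) :
    StronglyMeasurable fun y => ∫ l, H y l * g l ∂μ := by
  have e : (fun y => ∫ l, H y l * g l ∂μ) = fun y => ∫ l, H y l * hg.mk g l ∂μ := by
    funext y
    refine integral_congr_ae ?_
    filter_upwards [hg.ae_eq_mk] with l hl
    rw [hl]
  rw [e]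
  exact StronglyMeasurable.integral_prod_right
    (hH.mul (hg.stronglyMeasurable_mk.comp_measurable measurable_snd))

lemma norm_integral_mul_le {g : E → A} (hg : Integrable g μ) {k : E → A} {C : ℝ}
    (hk : ∀ l, ‖k l‖ ≤ C) : ‖∫ l, k l * g l ∂μ‖ ≤ C * ∫ l, ‖g l‖ ∂μ := by
  rw [← integral_const_mul]
  refine norm_integral_le_of_norm_le (hg.norm.const_mul C) (.of_forall fun l => ?_)
  exact (norm_mul_le _ _).trans (by gcongr; exact hk l)

namespace IsRegular

variable (hr : IsRegular μ G AI)

include hr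

lemma stronglyMeasurable_G_left (y : E) : StronglyMeasurable (G y) :=
  hr.meas.comp_measurable measurable_prodMk_left

lemma stronglyMeasurable_G_right (y : E) : StronglyMeasurable fun x => G x y :=
  hr.meas.comp_measurable measurable_prodMk_right

lemma integrable_AI_cons (n : ℕ) :
    Integrable (fun p : E × (Fin n → E) => AI (p.1 :: List.ofFn p.2))
      (μ.prod (Measure.pi fun _ => μ)) :=
  integrable_ofFn_succ μ (hr.int (n + 1))

lemma integrable_vertex {c : Forest L E}
    (hm : StronglyMeasurable fun v : Fin c.width → E => forestAmp μ G AI c (List.ofFn v))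
    (hb : ∃ D, ∀ ys, ‖forestAmp μ G AI c ys‖ ≤ D) :
    Integrable (fun p : E × (Fin c.width → E) =>
      AI (p.1 :: List.ofFn p.2) * forestAmp μ G AI c (List.ofFn p.2))
      (μ.prod (Measure.pi fun _ => μ)) := by
  obtain ⟨D, hD⟩ := hb
  exact (hr.integrable_AI_cons c.width).mul_bdd (c := D)
    (hm.comp_measurable measurable_snd).aestronglyMeasurable (.of_forall fun p => hD _)

/-- Bounded forest amplitudes make the vertex function integrable, and integrating it against the
bounded propagator gives a bounded measurable function again. -/
lemma forestAmp_regular (f : Forest L E) :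
    (∀ n, StronglyMeasurable fun v : Fin n → E => forestAmp μ G AI f (List.ofFn v)) ∧
      ∃ D, ∀ ys, ‖forestAmp μ G AI f ys‖ ≤ D := by
  obtain ⟨C, hC⟩ := hr.bdd
  -- Leaf and vertex are treated alike: a bounded measurable function of the first point times the
  -- amplitude of the remaining forest.
  have cons_case : ∀ {g : E → A} {f f' : Forest L E}, StronglyMeasurable g →
      (∃ D, ∀ y, ‖g y‖ ≤ D) →
      ((∀ n, StronglyMeasurable fun v : Fin n → E => forestAmp μ G AI f (List.ofFn v)) ∧
      ∃ D, ∀ ys, ‖forestAmp μ G AI f ys‖ ≤ D) →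
      forestAmp μ G AI f' [] = 0 →
      (∀ y ys, forestAmp μ G AI f' (y :: ys) = g y * forestAmp μ G AI f ys) →
      ((∀ n, StronglyMeasurable fun v : Fin n → E => forestAmp μ G AI f' (List.ofFn v)) ∧
      ∃ D, ∀ ys, ‖forestAmp μ G AI f' ys‖ ≤ D) := by
    rintro g f f' hg ⟨D, hD⟩ ⟨hf, D', hD'⟩ h0 h1
    refine ⟨fun n => ?_, |D| * |D'|, fun ys => ?_⟩
    · cases n with
      | zero => simp only [List.ofFn_zero]; exact stronglyMeasurable_const
      | succ n =>
        simp_rw [List.ofFn_succ, h1]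
        refine (hg.comp_measurable (measurable_pi_apply 0)).mul ((hf n).comp_measurable ?_)
        exact measurable_pi_lambda _ fun i => measurable_pi_apply _
    · cases ys with
      | nil => rw [h0, norm_zero]; positivity
      | cons y ys =>
        rw [h1]
        refine (norm_mul_le _ _).trans ?_
        gcongr
        · exact (hD y).trans (le_abs_self _)
        · exact (hD' ys).trans (le_abs_self _)
  induction f with
  | nil =>
    refine ⟨fun n => ?_, ‖(1 : A)‖, fun ys => ?_⟩
    · cases n with
      | zero => simp only [List.ofFn_zero]; exact stronglyMeasurable_const
      | succ n => simp only [List.ofFn_succ, forestAmp]; exact stronglyMeasurable_const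
    · cases ys <;> simp [forestAmp]
  | leaf j f ih =>
    exact cons_case (hr.stronglyMeasurable_G_right j) ⟨C, fun y => hC y j⟩ ih rfl fun _ _ => rfl
  | node i c f ihc ihf =>
    have hi := (hr.integrable_vertex (ihc.1 _) ihc.2).integral_prod_left
    exact cons_case (stronglyMeasurable_integral_mul hr.meas hi.aestronglyMeasurable)
      ⟨_, fun y => norm_integral_mul_le hi (hC y)⟩ ihf rfl fun _ _ => rfl

lemma integrable_AI_mul_forestAmp (c : Forest L E) (n : ℕ) :
    Integrable (fun p : E × (Fin n → E) =>
      AI (p.1 :: List.ofFn p.2) * forestAmp μ G AI c (List.ofFn p.2))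
      (μ.prod (Measure.pi fun _ => μ)) := by
  obtain ⟨D, hD⟩ := (hr.forestAmp_regular c).2
  exact (hr.integrable_AI_cons n).mul_bdd (c := D)
    (((hr.forestAmp_regular c).1 _).comp_measurable measurable_snd).aestronglyMeasurable
    (.of_forall fun p => hD _)

lemma integrable_vertexAmp (c : Forest L E) : Integrable (vertexAmp μ G AI c) μ :=
  (hr.integrable_AI_mul_forestAmp c c.width).integral_prod_left

lemma stronglyMeasurable_treeAmp (c : Forest L E) : StronglyMeasurable (treeAmp μ G AI c) :=
  stronglyMeasurable_integral_mul hr.meas (hr.integrable_vertexAmp c).aestronglyMeasurable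

lemma bdd_treeAmp (c : Forest L E) : ∃ D, ∀ y, ‖treeAmp μ G AI c y‖ ≤ D := by
  obtain ⟨C, hC⟩ := hr.bdd
  exact ⟨_, fun y => norm_integral_mul_le (hr.integrable_vertexAmp c) (hC y)⟩

end IsRegular

end Regularity

/-! ### The Feynman integral as a recursive amplitude -/

section Bridge

universe u

variable {E : Type u} {A L : Type*} [MeasurableSpace E]

/-- The space of the internal variables of a forest, arranged along the forest: a vertex with
children `c` contributes the variable `x`, grouped with those of the trees to its right, and the
variable `x'`, grouped with those of `c`. -/
def Internal : Forest L E → Type u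
  | .nil => PUnit
  | .leaf _ f => Internal f
  | .node _ c f => (E × Internal f) × (E × Internal c)

instance instMeasurableSpaceInternal : (f : Forest L E) → MeasurableSpace (Internal f)
  | .nil => inferInstanceAs (MeasurableSpace PUnit)
  | .leaf _ f => instMeasurableSpaceInternal f
  | .node _ c f =>
    letI := instMeasurableSpaceInternal c
    letI := instMeasurableSpaceInternal f
    inferInstanceAs (MeasurableSpace ((E × Internal f) × (E × Internal c)))

/-- The product measure on the space of internal variables. -/
def internalMeasure (μ : Measure E) : (f : Forest L E) → Measure (Internal f)
  | .nil => (Measure.dirac PUnit.unit : Measure PUnit)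
  | .leaf _ f => internalMeasure μ f
  | .node _ c f => (μ.prod (internalMeasure μ f)).prod (μ.prod (internalMeasure μ c))

instance instSigmaFiniteInternal (μ : Measure E) [SigmaFinite μ] :
    (f : Forest L E) → SigmaFinite (internalMeasure μ f)
  | .nil => inferInstanceAs (SigmaFinite (Measure.dirac PUnit.unit : Measure PUnit))
  | .leaf _ f => instSigmaFiniteInternal μ f
  | .node _ c f =>
    letI := instSigmaFiniteInternal μ c
    letI := instSigmaFiniteInternal μ f
    inferInstanceAs (SigmaFinite
      ((μ.prod (internalMeasure μ f)).prod (μ.prod (internalMeasure μ c))))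

lemma measurePreserving_elim0 (μ : Measure E) [SigmaFinite μ] :
    MeasurePreserving (fun _ : PUnit.{u + 1} => (Fin.elim0 : Fin 0 → E))
      (Measure.dirac PUnit.unit) (Measure.pi fun _ => μ) := by
  refine ⟨measurable_const, ?_⟩
  rw [Measure.map_dirac' measurable_const, Measure.pi_of_empty (x := Fin.elim0)]

variable (μ : Measure E) [NormedCommRing A] [NormedAlgebra ℝ A] (G : E → E → A)

/-- The partially amputated function of the lowest vertices of a forest. -/
def bottomAmp : (f : Forest L E) → (List E → A) → Internal f → A
  | .nil, h, _ => h []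
  | .leaf j f, h, z => ∫ y, G j y * bottomAmp f (fun b => h (y :: b)) z ∂μ
  | .node _ _ f, h, z => bottomAmp f (fun b => h (z.1.1 :: b)) z.1.2

/-- The product of the partially amputated functions and of the propagators of the inner vertices
of a forest. -/
def innerAmp (AI : List E → A) : (f : Forest L E) → Internal f → A
  | .nil, _ => 1
  | .leaf _ f, z => innerAmp AI f z
  | .node _ c f, z =>
    bottomAmp μ G c (fun b => AI (z.2.1 :: b)) z.2.2 * innerAmp AI c z.2.2 *
      innerAmp AI f z.1.2 * G z.1.1 z.2.1

variable {μ} [SigmaFinite μ] [CompleteSpace A] {G}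

namespace IsRegular

variable {AI : List E → A} (hr : IsRegular μ G AI)

include hr

/-- The parameter space `Θ` makes the induction close: each letter read off the forest moves from
the arguments of `h` to the parameters. -/
lemma aestronglyMeasurable_bottomAmp (f : Forest L E) {Θ : Type u} [MeasurableSpace Θ]
    (ν : Measure Θ) [SFinite ν] {h : Θ → List E → A}
    (hh : AEStronglyMeasurable (fun q : Θ × (Fin f.width → E) => h q.1 (List.ofFn q.2))
      (ν.prod (Measure.pi fun _ => μ))) :
    AEStronglyMeasurable (fun q : Θ × Internal f => bottomAmp μ G f (h q.1) q.2)
      (ν.prod (internalMeasure μ f)) := by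
  induction f generalizing Θ with
  | nil =>
    have h0 := measurePreserving_elim0.{u} μ
    have := hh.comp_measurePreserving ((MeasurePreserving.id ν).prod h0)
    exact this
  | leaf j f ih =>
    have h1 := ih (ν.prod μ) (h := fun q b => h q.1 (q.2 :: b))
      (aestronglyMeasurable_cons_param μ hh)
    have h2 := h1.comp_measurePreserving (measurePreserving_rotate μ (internalMeasure μ f))
    have h3 : AEStronglyMeasurable (fun q : (Θ × Internal f) × E => G j q.2)
        ((ν.prod (internalMeasure μ f)).prod μ) :=
      (hr.stronglyMeasurable_G_left j).aestronglyMeasurable.comp_snd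
    exact (h3.mul h2).integral_prod_right'
  | node i c f ihc ihf =>
    have h1 := ihf (ν.prod μ) (h := fun q b => h q.1 (q.2 :: b))
      (aestronglyMeasurable_cons_param μ hh)
    exact (h1.comp_fst (ν := μ.prod (internalMeasure μ c))).comp_measurePreserving
      (measurePreserving_split μ (internalMeasure μ f) (μ.prod (internalMeasure μ c)))

lemma aestronglyMeasurable_bottomAmp_AI (f : Forest L E) :
    AEStronglyMeasurable
      (fun q : E × Internal f => bottomAmp μ G f (fun b => AI (q.1 :: b)) q.2)
      (μ.prod (internalMeasure μ f)) :=
  hr.aestronglyMeasurable_bottomAmp f μ (h := fun y b => AI (y :: b))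
    (hr.integrable_AI_cons f.width).aestronglyMeasurable

lemma aestronglyMeasurable_innerAmp (f : Forest L E) :
    AEStronglyMeasurable (innerAmp μ G AI f) (internalMeasure μ f) := by
  induction f with
  | nil => exact aestronglyMeasurable_const
  | leaf j f ih => exact ih
  | node i c f ihc ihf =>
    have h1 : AEStronglyMeasurable (fun z : (E × Internal f) × (E × Internal c) =>
        bottomAmp μ G c (fun b => AI (z.2.1 :: b)) z.2.2)
        ((μ.prod (internalMeasure μ f)).prod (μ.prod (internalMeasure μ c))) :=
      (hr.aestronglyMeasurable_bottomAmp_AI c).comp_snd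
    have h2 : AEStronglyMeasurable (fun z : (E × Internal f) × (E × Internal c) =>
        innerAmp μ G AI c z.2.2)
        ((μ.prod (internalMeasure μ f)).prod (μ.prod (internalMeasure μ c))) :=
      (ihc.comp_snd (μ := μ)).comp_snd
    have h3 : AEStronglyMeasurable (fun z : (E × Internal f) × (E × Internal c) =>
        innerAmp μ G AI f z.1.2)
        ((μ.prod (internalMeasure μ f)).prod (μ.prod (internalMeasure μ c))) :=
      (ihf.comp_snd (μ := μ)).comp_fst
    have h4 : StronglyMeasurable (fun z : (E × Internal f) × (E × Internal c) =>
        G z.1.1 z.2.1) :=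
      hr.meas.comp_measurable (g := fun z : (E × Internal f) × (E × Internal c) => (z.1.1, z.2.1))
        (by fun_prop)
    exact ((h1.mul h2).mul h3).mul h4.aestronglyMeasurable

/-- The product of the real norms is estimated, not the norm of the product: the leaf case has to
divide by the inner factor, which is possible for a nonzero real number but not for an element of
`A`. -/
lemma integrable_norm_bottomAmp_mul (f : Forest L E) {Θ : Type u} [MeasurableSpace Θ]
    (ν : Measure Θ) [SFinite ν] {h : Θ → List E → A}
    (hh : Integrable (fun q : Θ × (Fin f.width → E) => h q.1 (List.ofFn q.2))
      (ν.prod (Measure.pi fun _ => μ))) :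
    Integrable (fun q : Θ × Internal f =>
      ‖bottomAmp μ G f (h q.1) q.2‖ * ‖innerAmp μ G AI f q.2‖)
      (ν.prod (internalMeasure μ f)) := by
  obtain ⟨C, hC⟩ := hr.bdd
  have hm := (hr.aestronglyMeasurable_bottomAmp f ν hh.aestronglyMeasurable).norm.mul
    ((hr.aestronglyMeasurable_innerAmp f).comp_snd (μ := ν)).norm
  induction f generalizing Θ with
  | nil =>
    have h0 := measurePreserving_elim0.{u} μ
    have := ((MeasurePreserving.id ν).prod h0).integrable_comp_of_integrable hh
    exact this.norm.mul_const ‖(1 : A)‖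
  | leaf j f ih =>
    have hh' := integrable_cons_param μ hh
    have h1 := ih (ν.prod μ) (h := fun q b => h q.1 (q.2 :: b)) hh'
      ((hr.aestronglyMeasurable_bottomAmp f (ν.prod μ)
        (h := fun q b => h q.1 (q.2 :: b)) hh'.aestronglyMeasurable).norm.mul
        ((hr.aestronglyMeasurable_innerAmp f).comp_snd).norm)
    have h2 := (measurePreserving_rotate μ (internalMeasure μ f)).integrable_comp_of_integrable h1
    have h4 := (h2.const_mul C).integral_prod_left
    refine h4.mono' hm ?_
    filter_upwards [h2.prod_right_ae] with q hq
    rw [norm_mul, norm_norm, norm_norm]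
    -- Where the inner factor vanishes, Fubini gives no integrability of the other factor, but the
    -- left-hand side is zero; elsewhere division by the norm gives it.
    by_cases hR : ‖innerAmp μ G AI f q.2‖ = 0
    · change _ * ‖innerAmp μ G AI f q.2‖ ≤ _
      rw [hR, mul_zero]
      refine integral_nonneg fun y => mul_nonneg ((norm_nonneg _).trans (hC j j)) ?_
      simp only [Function.comp]
      positivity
    · have hq' : Integrable (fun y =>
          C * ‖bottomAmp μ G f (fun b => h q.1 (y :: b)) q.2‖) μ := by
        refine Integrable.const_mul ?_ C
        refine (hq.mul_const ‖innerAmp μ G AI f q.2‖⁻¹).congr (.of_forall fun y => ?_)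
        simp only [Function.comp]
        field_simp
      calc ‖∫ y, G j y * bottomAmp μ G f (fun b => h q.1 (y :: b)) q.2 ∂μ‖ *
            ‖innerAmp μ G AI f q.2‖
          ≤ (∫ y, C * ‖bottomAmp μ G f (fun b => h q.1 (y :: b)) q.2‖ ∂μ) *
            ‖innerAmp μ G AI f q.2‖ := by
            gcongr
            refine norm_integral_le_of_norm_le hq' (.of_forall fun y => ?_)
            exact (norm_mul_le _ _).trans (by gcongr; exact hC _ _)
        _ = _ := by
            rw [← integral_mul_const]
            exact integral_congr_ae (.of_forall fun y => by simp only [Function.comp]; ring)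
  | node i c f ihc ihf =>
    have hh' := integrable_cons_param μ hh
    have h1 := ihf (ν.prod μ) (h := fun q b => h q.1 (q.2 :: b)) hh'
      ((hr.aestronglyMeasurable_bottomAmp f (ν.prod μ)
        (h := fun q b => h q.1 (q.2 :: b)) hh'.aestronglyMeasurable).norm.mul
        ((hr.aestronglyMeasurable_innerAmp f).comp_snd).norm)
    have h2 := ihc μ (h := fun y b => AI (y :: b)) (hr.integrable_AI_cons _)
      ((hr.aestronglyMeasurable_bottomAmp_AI c).norm.mul
        ((hr.aestronglyMeasurable_innerAmp c).comp_snd).norm)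
    have h3 := (measurePreserving_split μ (internalMeasure μ f)
      (μ.prod (internalMeasure μ c))).integrable_comp_of_integrable ((h1.mul_prod h2).const_mul C)
    refine h3.mono' hm (.of_forall fun q => ?_)
    rw [norm_mul, norm_norm, norm_norm]
    simp only [Function.comp, bottomAmp, innerAmp]
    calc _ ≤ ‖bottomAmp μ G f (fun b => h q.1 (q.2.1.1 :: b)) q.2.1.2‖ *
          (‖bottomAmp μ G c (fun b => AI (q.2.2.1 :: b)) q.2.2.2‖ * ‖innerAmp μ G AI c q.2.2.2‖ *
            ‖innerAmp μ G AI f q.2.1.2‖ * C) := by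
          gcongr
          refine (norm_mul_le _ _).trans (mul_le_mul ?_ (hC _ _) (norm_nonneg _) (by positivity))
          refine (norm_mul_le _ _).trans ?_
          gcongr
          exact norm_mul_le _ _
      _ = _ := by ring

lemma integrable_bottomAmp_mul (f : Forest L E) {Θ : Type u} [MeasurableSpace Θ]
    (ν : Measure Θ) [SFinite ν] {h : Θ → List E → A}
    (hh : Integrable (fun q : Θ × (Fin f.width → E) => h q.1 (List.ofFn q.2))
      (ν.prod (Measure.pi fun _ => μ))) :
    Integrable (fun q : Θ × Internal f =>
      bottomAmp μ G f (h q.1) q.2 * innerAmp μ G AI f q.2)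
      (ν.prod (internalMeasure μ f)) :=
  (hr.integrable_norm_bottomAmp_mul f ν hh).mono'
    ((hr.aestronglyMeasurable_bottomAmp f ν hh.aestronglyMeasurable).mul
      ((hr.aestronglyMeasurable_innerAmp f).comp_snd (μ := ν)))
    (.of_forall fun _ => norm_mul_le _ _)

/-- Fubini along the forest. The amputating variable of a leaf, integrated innermost in `bottomAmp`,
is moved outside; for a vertex, `x'` and the variables of its children are integrated first and
yield `treeAmp` at `x`. -/
lemma integral_bottomAmp_mul (f : Forest L E) {h : List E → A}
    (hh : Integrable (fun v : Fin f.width → E => h (List.ofFn v)) (Measure.pi fun _ => μ)) :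
    ∫ z, bottomAmp μ G f h z * innerAmp μ G AI f z ∂(internalMeasure μ f) =
      ∫ v : Fin f.width → E, h (List.ofFn v) * forestAmp μ G AI f (List.ofFn v)
        ∂(Measure.pi fun _ => μ) := by
  obtain ⟨C, hC⟩ := hr.bdd
  induction f generalizing h with
  | nil =>
    have e1 : ∫ z : PUnit, h [] * 1 ∂(Measure.dirac PUnit.unit) = h [] * 1 := by
      rw [integral_dirac]
    have e2 : ∫ v : Fin 0 → E, h (List.ofFn v) * forestAmp μ G AI (.nil : Forest L E) (List.ofFn v)
        ∂(Measure.pi fun _ => μ) = h [] * 1 := by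
      rw [Measure.pi_of_empty (x := Fin.elim0), integral_dirac]
      rfl
    exact e1.trans e2.symm
  | leaf j f ih =>
    have hh' := integrable_ofFn_succ μ hh
    have h1 := hr.integrable_norm_bottomAmp_mul f μ (h := fun y b => h (y :: b)) hh'
    have h2 := hr.integrable_bottomAmp_mul f μ (h := fun y b => h (y :: b)) hh'
    have hGj : AEStronglyMeasurable (fun q : E × Internal f => G j q.1)
        (μ.prod (internalMeasure μ f)) :=
      (hr.stronglyMeasurable_G_left j).aestronglyMeasurable.comp_fst
    have h3 := h2.bdd_mul hGj (.of_forall fun q => hC j q.1)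
    -- Moving a factor from `A` into the integral uses integrability, available for almost every `z`
    -- with nonzero inner factor.
    have e1 : ∀ᵐ z ∂(internalMeasure μ f),
        (∫ y, G j y * bottomAmp μ G f (fun b => h (y :: b)) z ∂μ) * innerAmp μ G AI f z =
        ∫ y, G j y * (bottomAmp μ G f (fun b => h (y :: b)) z * innerAmp μ G AI f z) ∂μ := by
      have hm := (hr.aestronglyMeasurable_bottomAmp f μ (h := fun y b => h (y :: b))
        hh'.aestronglyMeasurable).prod_swap.prodMk_left
      filter_upwards [h1.prod_left_ae, hm] with z hz hmz
      by_cases hR : ‖innerAmp μ G AI f z‖ = 0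
      · simp [norm_eq_zero.1 hR]
      · have hi : Integrable (fun y => bottomAmp μ G f (fun b => h (y :: b)) z) μ := by
          rw [← integrable_norm_iff (by exact hmz)]
          refine (hz.mul_const ‖innerAmp μ G AI f z‖⁻¹).congr (.of_forall fun y => ?_)
          simp only
          field_simp
        rw [← integral_mul_const_of_integrable]
        · simp_rw [mul_assoc]
        · exact hi.bdd_mul (hr.stronglyMeasurable_G_left j).aestronglyMeasurable
            (.of_forall fun y => hC j y)
    have e2 : ∀ᵐ y ∂μ,
        ∫ z, G j y * (bottomAmp μ G f (fun b => h (y :: b)) z * innerAmp μ G AI f z)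
          ∂(internalMeasure μ f) =
        ∫ v : Fin f.width → E, h (y :: List.ofFn v) *
          forestAmp μ G AI (.leaf j f) (y :: List.ofFn v) ∂(Measure.pi fun _ => μ) := by
      filter_upwards [h2.prod_right_ae, hh'.prod_right_ae] with y hy hy'
      rw [integral_const_mul_of_integrable hy, ih hy', ← integral_const_mul_of_integrable]
      -- The Feynman rule reads the propagator from the external letter to the vertex, `forestAmp`
      -- in the opposite direction.
      · simp only [forestAmp, hr.symm y j]
        congr 1
        funext v
        ring
      · obtain ⟨D, hD⟩ := (hr.forestAmp_regular f).2
        exact hy'.mul_bdd (c := D) ((hr.forestAmp_regular f).1 _).aestronglyMeasurable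
          (.of_forall fun v => hD _)
    have h4 : Integrable (fun p : E × (Fin f.width → E) => h (p.1 :: List.ofFn p.2) *
        forestAmp μ G AI (.leaf j f) (p.1 :: List.ofFn p.2))
        (μ.prod (Measure.pi fun _ => μ)) := by
      obtain ⟨D, hD⟩ := (hr.forestAmp_regular (.leaf j f)).2
      exact integrable_ofFn_succ μ (h := fun v => h v * forestAmp μ G AI (.leaf j f) v)
        (hh.mul_bdd (c := D) ((hr.forestAmp_regular (.leaf j f)).1 _).aestronglyMeasurable
          (.of_forall fun v => hD _))
    calc _ = ∫ z, ∫ y, G j y * (bottomAmp μ G f (fun b => h (y :: b)) z * innerAmp μ G AI f z) ∂μ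
            ∂(internalMeasure μ f) := integral_congr_ae e1
      _ = ∫ y, ∫ z, G j y * (bottomAmp μ G f (fun b => h (y :: b)) z * innerAmp μ G AI f z)
            ∂(internalMeasure μ f) ∂μ := (integral_integral_swap h3).symm
      _ = _ := integral_congr_ae e2
      _ = _ := (integral_prod _ h4).symm
      _ = _ := (integral_ofFn_succ μ
          (fun v => h v * forestAmp μ G AI (.leaf j f) v)).symm
  | node i c f ihc ihf =>
    have hh' := integrable_ofFn_succ μ hh
    have hf := hr.integrable_bottomAmp_mul f μ (h := fun y b => h (y :: b)) hh'
    have hc := hr.integrable_bottomAmp_mul c μ (h := fun y b => AI (y :: b))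
      (hr.integrable_AI_cons _)
    have hGx : ∀ x, AEStronglyMeasurable (fun q : E × Internal c => G x q.1)
        (μ.prod (internalMeasure μ c)) := fun x =>
      (hr.stronglyMeasurable_G_left x).aestronglyMeasurable.comp_fst
    have hc' : ∀ x, Integrable (fun q : E × Internal c => G x q.1 *
        (bottomAmp μ G c (fun b => AI (q.1 :: b)) q.2 * innerAmp μ G AI c q.2))
        (μ.prod (internalMeasure μ c)) := fun x =>
      hc.bdd_mul (hGx x) (.of_forall fun q => hC x q.1)
    have hint : Integrable (fun z : (E × Internal f) × (E × Internal c) =>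
        G z.1.1 z.2.1 * ((bottomAmp μ G f (fun b => h (z.1.1 :: b)) z.1.2 *
          innerAmp μ G AI f z.1.2) * (bottomAmp μ G c (fun b => AI (z.2.1 :: b)) z.2.2 *
          innerAmp μ G AI c z.2.2)))
        ((μ.prod (internalMeasure μ f)).prod (μ.prod (internalMeasure μ c))) := by
      refine (hf.mul_prod hc).bdd_mul (c := C) ?_ (.of_forall fun z => hC _ _)
      exact (hr.meas.comp_measurable
        (g := fun z : (E × Internal f) × (E × Internal c) => (z.1.1, z.2.1))
        (by fun_prop)).aestronglyMeasurable
    -- The block formed by `x'` and the variables above it is coupled to the rest only through the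
    -- propagator to `x`.
    have e1 : ∀ x, ∫ q : E × Internal c, G x q.1 *
        (bottomAmp μ G c (fun b => AI (q.1 :: b)) q.2 * innerAmp μ G AI c q.2)
        ∂(μ.prod (internalMeasure μ c)) = treeAmp μ G AI c x := by
      intro x
      rw [integral_prod _ (hc' x)]
      refine integral_congr_ae ?_
      filter_upwards [hc.prod_right_ae, (hr.integrable_AI_cons c.width).prod_right_ae] with y hy hy'
      rw [integral_const_mul_of_integrable hy, ihc hy']
      rfl
    have htf : Integrable (fun q : E × Internal f => treeAmp μ G AI c q.1 *
        (bottomAmp μ G f (fun b => h (q.1 :: b)) q.2 * innerAmp μ G AI f q.2))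
        (μ.prod (internalMeasure μ f)) := by
      obtain ⟨D, hD⟩ := hr.bdd_treeAmp c
      exact hf.bdd_mul (c := D) ((hr.stronglyMeasurable_treeAmp c).aestronglyMeasurable.comp_fst)
        (.of_forall fun q => hD _)
    have h4 : Integrable (fun p : E × (Fin f.width → E) => h (p.1 :: List.ofFn p.2) *
        forestAmp μ G AI (.node i c f) (p.1 :: List.ofFn p.2))
        (μ.prod (Measure.pi fun _ => μ)) := by
      obtain ⟨D, hD⟩ := (hr.forestAmp_regular (.node i c f)).2
      exact integrable_ofFn_succ μ (h := fun v => h v * forestAmp μ G AI (.node i c f) v)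
        (hh.mul_bdd (c := D) ((hr.forestAmp_regular (.node i c f)).1 _).aestronglyMeasurable
          (.of_forall fun v => hD _))
    calc _ = ∫ z : (E × Internal f) × (E × Internal c),
          G z.1.1 z.2.1 * ((bottomAmp μ G f (fun b => h (z.1.1 :: b)) z.1.2 *
          innerAmp μ G AI f z.1.2) * (bottomAmp μ G c (fun b => AI (z.2.1 :: b)) z.2.2 *
          innerAmp μ G AI c z.2.2))
          ∂((μ.prod (internalMeasure μ f)).prod (μ.prod (internalMeasure μ c))) := by
          refine integral_congr_ae (.of_forall fun z => ?_)
          simp only [bottomAmp, innerAmp]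
          ring
      _ = ∫ q : E × Internal f, treeAmp μ G AI c q.1 *
          (bottomAmp μ G f (fun b => h (q.1 :: b)) q.2 * innerAmp μ G AI f q.2)
          ∂(μ.prod (internalMeasure μ f)) := by
          rw [integral_prod _ hint]
          refine integral_congr_ae (.of_forall fun q => ?_)
          simp only
          rw [← e1, ← integral_mul_const_of_integrable (hc' _)]
          refine integral_congr_ae (.of_forall fun p => ?_)
          simp only
          ring
      _ = ∫ x, ∫ v : Fin f.width → E, h (x :: List.ofFn v) *
            forestAmp μ G AI (.node i c f) (x :: List.ofFn v) ∂(Measure.pi fun _ => μ) ∂μ := by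
          rw [integral_prod _ htf]
          refine integral_congr_ae ?_
          filter_upwards [hf.prod_right_ae, hh'.prod_right_ae] with x hx hx'
          rw [integral_const_mul_of_integrable hx, ihf hx', ← integral_const_mul_of_integrable]
          · simp only [forestAmp_node]
            congr 1
            funext v
            ring
          · obtain ⟨D, hD⟩ := (hr.forestAmp_regular f).2
            exact hx'.mul_bdd (c := D) ((hr.forestAmp_regular f).1 _).aestronglyMeasurable
              (.of_forall fun v => hD _)
      _ = _ := (integral_prod _ h4).symm
      _ = _ := (integral_ofFn_succ μ
          (fun v => h v * forestAmp μ G AI (.node i c f) v)).symm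

end IsRegular

end Bridge

/-! ### Labelled variables versus variables arranged along the forest -/

section Coordinates

universe u

variable {E : Type u} {A L : Type*} [MeasurableSpace E]

/-- The values of the internal variables of a forest: `z (inl i)` is the value of `x_i` and
`z (inr i)` that of `x_i'`. -/
def readInternal : (f : Forest L E) → (L ⊕ L → E) → Internal f
  | .nil, _ => PUnit.unit
  | .leaf _ f, z => readInternal f z
  | .node i c f, z => ((z (.inl i), readInternal f z), (z (.inr i), readInternal c z))

/-- The assignment of values to the variables of a forest, extending a given assignment. -/
def writeInternal [DecidableEq L] : (f : Forest L E) → Internal f → (L ⊕ L → E) → L ⊕ L → E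
  | .nil, _, z => z
  | .leaf _ f, y, z => writeInternal f y z
  | .node i c f, y, z =>
    Function.update (Function.update (writeInternal f y.1.2 (writeInternal c y.2.2 z))
      (.inl i) y.1.1) (.inr i) y.2.1

/-- The product of the sets `s k` in the space of internal variables. -/
def internalBox (s : L ⊕ L → Set E) : (f : Forest L E) → Set (Internal f)
  | .nil => Set.univ
  | .leaf _ f => internalBox s f
  | .node i c f => (s (.inl i) ×ˢ internalBox s f) ×ˢ (s (.inr i) ×ˢ internalBox s c)

lemma internalMeasure_internalBox (μ : Measure E) [SigmaFinite μ] (s : L ⊕ L → Set E)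
    (f : Forest L E) : internalMeasure μ f (internalBox s f) =
      (f.labels.map fun i => μ (s (.inl i)) * μ (s (.inr i))).prod := by
  induction f with
  | nil =>
    change (Measure.dirac PUnit.unit : Measure PUnit) Set.univ = _
    simp [Forest.labels]
  | leaf j f ih => exact ih
  | node i c f ihc ihf =>
    change ((μ.prod (internalMeasure μ f)).prod (μ.prod (internalMeasure μ c)))
      ((s (.inl i) ×ˢ internalBox s f) ×ˢ (s (.inr i) ×ˢ internalBox s c)) = _
    simp only [Measure.prod_prod, ihc, ihf, Forest.labels, List.map_cons, List.map_append,
      List.prod_cons, List.prod_append]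
    ring

lemma readInternal_mem_internalBox (s : L ⊕ L → Set E) (f : Forest L E) (z : L ⊕ L → E) :
    readInternal f z ∈ internalBox s f ↔
      ∀ i ∈ f.labels, z (.inl i) ∈ s (.inl i) ∧ z (.inr i) ∈ s (.inr i) := by
  induction f with
  | nil => simp [Forest.labels, internalBox]
  | leaf j f ih => exact ih
  | node i c f ihc ihf =>
    change (z (.inl i) ∈ s (.inl i) ∧ readInternal f z ∈ internalBox s f) ∧
      (z (.inr i) ∈ s (.inr i) ∧ readInternal c z ∈ internalBox s c) ↔ _
    rw [ihc, ihf]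
    simp only [Forest.labels, List.mem_cons, List.mem_append]
    constructor
    · rintro ⟨⟨h1, h2⟩, h3, h4⟩ k (rfl | hk | hk)
      exacts [⟨h1, h3⟩, h4 k hk, h2 k hk]
    · exact fun h => ⟨⟨(h i (.inl rfl)).1, fun k hk => h k (.inr (.inr hk))⟩,
        (h i (.inl rfl)).2, fun k hk => h k (.inr (.inl hk))⟩

lemma readInternal_congr (f : Forest L E) {z z' : L ⊕ L → E}
    (h : ∀ i ∈ f.labels, z (.inl i) = z' (.inl i) ∧ z (.inr i) = z' (.inr i)) :
    readInternal f z = readInternal f z' := by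
  induction f with
  | nil => rfl
  | leaf j f ih => exact ih h
  | node i c f ihc ihf =>
    simp only [Forest.labels, List.mem_cons, List.mem_append] at h
    simp only [readInternal]
    rw [ihc fun k hk => h k (.inr (.inl hk)), ihf fun k hk => h k (.inr (.inr hk)),
      (h i (.inl rfl)).1, (h i (.inl rfl)).2]

variable [DecidableEq L]

lemma writeInternal_of_notMem (f : Forest L E) (y : Internal f) (z : L ⊕ L → E) {i : L}
    (hi : i ∉ f.labels) : writeInternal f y z (.inl i) = z (.inl i) ∧
      writeInternal f y z (.inr i) = z (.inr i) := by
  induction f generalizing z with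
  | nil => exact ⟨rfl, rfl⟩
  | leaf j f ih => exact ih y z hi
  | node k c f ihc ihf =>
    simp only [Forest.labels, List.mem_cons, List.mem_append, not_or] at hi
    simp [writeInternal, hi.1, ihc y.2.2 z hi.2.1, ihf y.1.2 _ hi.2.2]

lemma read_writeInternal {f : Forest L E} (hf : f.labels.Nodup) (y : Internal f)
    (z : L ⊕ L → E) : readInternal f (writeInternal f y z) = y := by
  induction f generalizing z with
  | nil => rfl
  | leaf j f ih => exact ih hf y z
  | node k c f ihc ihf =>
    simp only [Forest.labels, List.nodup_cons, List.mem_append, not_or, List.nodup_append] at hf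
    have h1 : ∀ i, i ≠ k →
        writeInternal (.node k c f) y z (.inl i) =
          writeInternal f y.1.2 (writeInternal c y.2.2 z) (.inl i) ∧
        writeInternal (.node k c f) y z (.inr i) =
          writeInternal f y.1.2 (writeInternal c y.2.2 z) (.inr i) := by
      intro i hi
      simp [writeInternal, hi]
    have h2 : readInternal f (writeInternal (.node k c f) y z) = y.1.2 := by
      rw [← ihf hf.2.2.1 y.1.2 (writeInternal c y.2.2 z)]
      refine readInternal_congr f fun i hi => ?_
      exact h1 i fun h => hf.1.2 (h ▸ hi)
    have h3 : readInternal c (writeInternal (.node k c f) y z) = y.2.2 := by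
      rw [← ihc hf.2.1 y.2.2 z]
      refine readInternal_congr c fun i hi => ?_
      have h4 := h1 i fun h => hf.1.1 (h ▸ hi)
      have h5 := writeInternal_of_notMem f y.1.2 (writeInternal c y.2.2 z) (i := i)
        fun h => hf.2.2.2 i hi i h rfl
      exact ⟨h4.1.trans h5.1, h4.2.trans h5.2⟩
    have h6 : writeInternal (.node k c f) y z (.inl k) = y.1.1 := by simp [writeInternal]
    have h7 : writeInternal (.node k c f) y z (.inr k) = y.2.1 := by simp [writeInternal]
    simp only [readInternal, h2, h3, h6, h7]
    rfl

lemma measurable_readInternal (f : Forest L E) : Measurable (readInternal f) := by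
  induction f with
  | nil => exact (measurable_const : Measurable fun _ : L ⊕ L → E => PUnit.unit)
  | leaf j f ih => exact ih
  | node i c f ihc ihf =>
    exact ((measurable_pi_apply _).prodMk ihf).prodMk ((measurable_pi_apply _).prodMk ihc)

lemma measurable_writeInternal (f : Forest L E) :
    Measurable fun p : Internal f × (L ⊕ L → E) => writeInternal f p.1 p.2 := by
  induction f with
  | nil => exact measurable_snd
  | leaf j f ih => exact ih
  | node i c f ihc ihf =>
    have h1 : Measurable fun p : ((E × Internal f) × (E × Internal c)) × (L ⊕ L → E) =>
        writeInternal f p.1.1.2 (writeInternal c p.1.2.2 p.2) :=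
      ihf.comp ((by fun_prop : Measurable fun p : ((E × Internal f) × (E × Internal c)) ×
        (L ⊕ L → E) => p.1.1.2).prodMk (ihc.comp (by fun_prop : Measurable fun p :
          ((E × Internal f) × (E × Internal c)) × (L ⊕ L → E) => (p.1.2.2, p.2))))
    have h2 : Measurable fun p : ((E × Internal f) × (E × Internal c)) × (L ⊕ L → E) =>
        Function.update (Function.update (writeInternal f p.1.1.2 (writeInternal c p.1.2.2 p.2))
          (.inl i) p.1.1.1) (.inr i) p.1.2.1 := by
      refine measurable_pi_lambda _ fun k => ?_
      have h3 := (measurable_pi_apply k).comp h1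
      by_cases hk : k = .inr i
      · subst hk; simp only [Function.update_self]; fun_prop
      · simp only [Function.update_of_ne hk]
        by_cases hk' : k = .inl i
        · subst hk'; simp only [Function.update_self]; fun_prop
        · simp only [Function.update_of_ne hk']
          exact h3
    exact h2

/-- Writing is a right inverse of reading, and the image of `internalMeasure` under writing has the
right values on boxes, which characterises the product measure; reading then undoes the writing. -/
lemma measurePreserving_readInternal [Fintype L] [Nonempty E] (μ : Measure E) [SigmaFinite μ]
    {f : Forest L E} (hf : f.labels.Nodup) (hf' : ∀ i, i ∈ f.labels) :
    MeasurePreserving (readInternal f) (Measure.pi fun _ => μ) (internalMeasure μ f) := by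
  -- The starting assignment is immaterial: every label occurs, so every coordinate is overwritten.
  have hz : Measurable fun y : Internal f => writeInternal f y fun _ => Classical.arbitrary E :=
    (measurable_writeInternal f).comp (measurable_id.prodMk measurable_const)
  have hmap : Measure.pi (fun _ : L ⊕ L => μ) = Measure.map
      (fun y : Internal f => writeInternal f y fun _ => Classical.arbitrary E)
      (internalMeasure μ f) := by
    refine Measure.pi_eq fun s hs => ?_
    rw [Measure.map_apply hz (MeasurableSet.univ_pi hs)]
    have e : (fun y : Internal f => writeInternal f y fun _ => Classical.arbitrary E) ⁻¹'
        Set.univ.pi s = internalBox s f := by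
      ext y
      have := readInternal_mem_internalBox s f (writeInternal f y fun _ => Classical.arbitrary E)
      rw [read_writeInternal hf] at this
      rw [this, Set.mem_preimage, Set.mem_univ_pi]
      exact ⟨fun h i _ => ⟨h _, h _⟩, fun h i => by
        rcases i with i | i
        · exact (h i (hf' i)).1
        · exact (h i (hf' i)).2⟩
    rw [e, internalMeasure_internalBox, Fintype.prod_sum_type, ← Finset.prod_mul_distrib,
      ← List.prod_toFinset _ hf]
    congr 1
    ext i
    simp [hf' i]
  refine ⟨measurable_readInternal f, ?_⟩
  rw [hmap, Measure.map_map (measurable_readInternal f) hz]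
  have : readInternal f ∘ (fun y : Internal f => writeInternal f y fun _ =>
      Classical.arbitrary E) = id := by
    funext y
    exact read_writeInternal hf y _
  rw [this, Measure.map_id]

end Coordinates

/-! ### The Feynman amplitude of a decreasing tree -/

section Amplitude

universe u

variable {E : Type u} {A : Type*} [MeasurableSpace E] (μ : Measure E)
  [NormedCommRing A] [NormedAlgebra ℝ A] (G : E → E → A) {n : ℕ}

lemma partiallyAmputated_bottom (f : Forest (Fin n) E) (h : List E → A)
    (z : Fin n ⊕ Fin n → E) :
    partiallyAmputated μ G h (f.bottom.map (evalLetter (z ∘ Sum.inl, z ∘ Sum.inr))) =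
      bottomAmp μ G f h (readInternal f z) := by
  induction f generalizing h with
  | nil => rfl
  | leaf j f ih =>
    simp only [Forest.bottom, List.map_cons, evalLetter, partiallyAmputated, ih, bottomAmp,
      readInternal]
  | node i c f _ ih =>
    simp only [Forest.bottom, List.map_cons, evalLetter, partiallyAmputated, ih, bottomAmp,
      readInternal, Function.comp]

lemma prod_monomials (AI : List E → A) (f : Forest (Fin n) E) (z : Fin n ⊕ Fin n → E) :
    (f.monomials.map fun a => partiallyAmputated μ G AI
      (a.map (evalLetter (z ∘ Sum.inl, z ∘ Sum.inr)))).prod *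
      (f.labels.map fun i => G (z (.inl i)) (z (.inr i))).prod =
      innerAmp μ G AI f (readInternal f z) := by
  induction f with
  | nil => simp [Forest.monomials, Forest.labels, innerAmp]
  | leaf j f ih => exact ih
  | node i c f ihc ihf =>
    simp only [Forest.monomials, Forest.labels, List.map_cons, List.map_append, List.prod_cons,
      List.prod_append, evalLetter, partiallyAmputated, partiallyAmputated_bottom, innerAmp,
      readInternal, ← ihc, ← ihf, Function.comp]
    ring

variable {μ G} [SigmaFinite μ] [CompleteSpace A] {AI : List E → A}

lemma IsRegular.amplitude_monomials (hr : IsRegular μ G AI) {T : Tree (Fin n) E}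
    (hT : T.IsDecreasing) :
    amplitude μ G AI T.monomials = treeAmp μ G AI T.branches T.root := by
  obtain ⟨r, f⟩ := T
  have hn : f.labels.Nodup := hT.nodup_labels
  have hp : f.labels.Perm (List.finRange n) := hT.2
  have : Nonempty E := ⟨r⟩
  -- Placing the root as an extra leaf in front of the branches turns the root monomial into the
  -- bottom word of a forest, so the bridge applies with `h = AI`.
  let F : Forest (Fin n) E := .leaf r f
  have hmp : MeasurePreserving (readInternal F) (Measure.pi fun _ => μ) (internalMeasure μ F) :=
    measurePreserving_readInternal μ hn fun i => hp.mem_iff.2 (List.mem_finRange i)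
  have hA := hr.int F.width
  have h1 := (measurePreserving_sumPiEquivProdPi
    (ι := Fin n) (ι' := Fin n) (X := fun _ => E) fun _ => μ).integral_comp'
    (g := fun z : (Fin n → E) × (Fin n → E) =>
      ((Tree.monomials ⟨r, f⟩).map fun a =>
        partiallyAmputated μ G AI (a.map (evalLetter z))).prod * ∏ i, G (z.1 i) (z.2 i))
  have h2 : ∀ z : Fin n ⊕ Fin n → E, ((Tree.monomials ⟨r, f⟩).map fun a =>
        partiallyAmputated μ G AI (a.map (evalLetter (z ∘ Sum.inl, z ∘ Sum.inr)))).prod *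
          ∏ i, G (z (.inl i)) (z (.inr i)) =
      bottomAmp μ G F AI (readInternal F z) * innerAmp μ G AI F (readInternal F z) := by
    intro z
    have e1 : ∏ i, G (z (.inl i)) (z (.inr i)) =
        (f.labels.map fun i => G (z (.inl i)) (z (.inr i))).prod := by
      rw [(hp.map _).prod_eq, ← List.ofFn_eq_map, List.prod_ofFn]
    have e2 := partiallyAmputated_bottom μ G F AI z
    have e3 := prod_monomials μ G AI F z
    simp only [F, Forest.bottom, Forest.monomials, Forest.labels] at e2 e3
    rw [← e2, ← e3, e1, Tree.monomials, List.map_cons, List.prod_cons, mul_assoc]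
  -- No parameter is left here; the parametrised lemma is applied over a one-point space.
  have h3 : AEStronglyMeasurable (fun y => bottomAmp μ G F AI y * innerAmp μ G AI F y)
      (internalMeasure μ F) := by
    have hm : MeasurePreserving (fun q : PUnit.{u + 1} × (Fin F.width → E) => q.2)
        ((Measure.dirac PUnit.unit).prod (Measure.pi fun _ => μ)) (Measure.pi fun _ => μ) :=
      measurePreserving_snd
    have h4 := (hr.integrable_bottomAmp_mul F (Measure.dirac PUnit.unit : Measure PUnit.{u + 1})
      (h := fun _ => AI) (hm.integrable_comp_of_integrable hA)).aestronglyMeasurable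
    exact h4.of_comp_snd (NeZero.ne _)
  have h5 : treeAmp μ G AI f r = ∫ p : E × (Fin f.width → E), AI (p.1 :: List.ofFn p.2) *
      forestAmp μ G AI F (p.1 :: List.ofFn p.2) ∂(μ.prod (Measure.pi fun _ => μ)) := by
    obtain ⟨D, hD⟩ := (hr.forestAmp_regular F).2
    rw [integral_prod _ (integrable_ofFn_succ μ (h := fun v => AI v * forestAmp μ G AI F v)
      ((hr.int _).mul_bdd (c := D) ((hr.forestAmp_regular F).1 _).aestronglyMeasurable
          (.of_forall fun v => hD _)))]
    refine integral_congr_ae ?_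
    filter_upwards [(hr.integrable_AI_mul_forestAmp f f.width).prod_right_ae] with l hl
    rw [vertexAmp, ← integral_const_mul_of_integrable hl]
    simp only [F, forestAmp, hr.symm r l]
    congr 1
    funext v
    ring
  calc amplitude μ G AI (Tree.monomials ⟨r, f⟩)
      = ∫ z : Fin n ⊕ Fin n → E, bottomAmp μ G F AI (readInternal F z) *
          innerAmp μ G AI F (readInternal F z) ∂(Measure.pi fun _ => μ) := by
        rw [amplitude, ← h1]
        exact integral_congr_ae (.of_forall fun z => h2 z)
    _ = ∫ y, bottomAmp μ G F AI y * innerAmp μ G AI F y ∂(internalMeasure μ F) := by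
        rw [← hmp.map_eq] at h3 ⊢
        exact (integral_map hmp.measurable.aemeasurable h3).symm
    _ = _ := hr.integral_bottomAmp_mul F hA
    _ = _ := integral_ofFn_succ μ (fun v => AI v * forestAmp μ G AI F v)
    _ = _ := h5.symm

end Amplitude

/-! ### Sums over shapes -/

section Shapes

open scoped ENNReal Classical

variable {E : Type*}

/-- The leaves of a single tree: a leaf or a vertex with its children. -/
def treeLeaves : E ⊕ Forest Unit E → List E
  | .inl j => [j]
  | .inr c => c.leaves

/-- The forest with a given first tree. -/
def consTree : (E ⊕ Forest Unit E) × Forest Unit E → Forest Unit E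
  | (.inl j, f) => .leaf j f
  | (.inr c, f) => .node () c f

lemma leaves_consTree (x : (E ⊕ Forest Unit E) × Forest Unit E) :
    (consTree x).leaves = treeLeaves x.1 ++ x.2.leaves := by
  obtain ⟨j | c, f⟩ := x <;> rfl

lemma consTree_injective : Function.Injective (consTree (E := E)) := by
  rintro ⟨j | c, f⟩ ⟨j' | c', f'⟩ h <;> simp_all [consTree]

lemma notMem_range_consTree {f : Forest Unit E} :
    f ∉ Set.range (consTree (E := E)) ↔ f = .nil := by
  cases f with
  | nil => simp only [iff_true]; rintro ⟨⟨j | c, f⟩, h⟩ <;> simp [consTree] at h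
  | leaf j f => exact iff_of_false (fun h => h ⟨(.inl j, f), rfl⟩) (by simp)
  | node u c f => exact iff_of_false (fun h => h ⟨(.inr c, f), rfl⟩) (by simp)

lemma tsum_forest (φ : Forest Unit E → ℝ≥0∞) :
    ∑' f, φ f = φ .nil + ∑' x, φ (consTree x) := by
  rw [ENNReal.tsum_eq_add_tsum_ite .nil]
  congr 1
  rw [← consTree_injective.tsum_eq]
  · refine tsum_congr fun x => ?_
    rw [if_neg]
    intro h
    exact notMem_range_consTree.2 h ⟨x, rfl⟩
  · intro f hf
    by_contra h
    simp [notMem_range_consTree.1 h] at hf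

/-- A concatenation equals `w` if and only if `w` is cut accordingly at exactly one position. -/
lemma ite_append_eq {R J : Type*} [Semiring R] (a b w : List J) (x y : R) :
    (if a ++ b = w then x * y else 0) =
      ∑ k ∈ Finset.range (w.length + 1),
        (if a = w.take k then x else 0) * (if b = w.drop k then y else 0) := by
  by_cases h : a ++ b = w
  · subst h
    rw [if_pos rfl, Finset.sum_eq_single a.length]
    · simp
    · intro k hk hne
      rw [if_neg, zero_mul]
      intro h
      have := congrArg List.length h
      simp only [Finset.mem_range, List.length_append, List.length_take] at hk this
      omega
    · simp
  · rw [if_neg h]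
    refine (Finset.sum_eq_zero fun k _ => ?_).symm
    by_cases h1 : a = w.take k
    · rw [if_neg (c := b = w.drop k), mul_zero]
      rintro h2
      exact h (by rw [h1, h2, List.take_append_drop])
    · rw [if_neg h1, zero_mul]

lemma tsum_mul_ite_append (w : List E) (β : E ⊕ Forest Unit E → ℝ≥0∞)
    (κ : Forest Unit E → ℝ≥0∞) :
    ∑' x : (E ⊕ Forest Unit E) × Forest Unit E,
      (if treeLeaves x.1 ++ x.2.leaves = w then β x.1 * κ x.2 else 0) =
    ∑ k ∈ Finset.range (w.length + 1), (∑' t, if treeLeaves t = w.take k then β t else 0) *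
      ∑' f, if f.leaves = w.drop k then κ f else 0 := by
  simp_rw [ite_append_eq]
  rw [Summable.tsum_finsetSum fun _ _ => ENNReal.summable]
  refine Finset.sum_congr rfl fun k _ => ?_
  rw [ENNReal.tsum_prod (f := fun (t : E ⊕ Forest Unit E) (f : Forest Unit E) =>
    (if treeLeaves t = w.take k then β t else 0) * (if f.leaves = w.drop k then κ f else 0))]
  simp_rw [ENNReal.tsum_mul_left, ENNReal.tsum_mul_right]

/-- The shapes with given leaves are countably many. -/
lemma countable_leaves_eq (w : List E) : {f : Forest Unit E | f.leaves = w}.Countable := by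
  -- The three constructors get the codes zero, odd and positive even; a leaf is recorded by its
  -- position in `w`.
  let code : Forest Unit E → ℕ := fun f => f.rec 0
    (fun j _ n => 2 * Nat.pair (w.idxOf j) n + 1) (fun _ _ _ m n => 2 * Nat.pair m n + 2)
  have hc : Set.InjOn code {f | ∀ j ∈ f.leaves, j ∈ w} := by
    intro f hf g hg h
    induction f generalizing g with
    | nil =>
      cases g with
      | nil => rfl
      | leaf j g => simp [code] at h
      | node u c g => simp [code] at h
    | leaf j f ih =>
      cases g with
      | nil => simp [code] at h
      | leaf j' g =>
        have h' : 2 * Nat.pair (w.idxOf j) (code f) + 1 =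
          2 * Nat.pair (w.idxOf j') (code g) + 1 := h
        have h1 : Nat.pair (w.idxOf j) (code f) = Nat.pair (w.idxOf j') (code g) := by omega
        rw [Nat.pair_eq_pair] at h1
        simp only [Set.mem_ofPred_eq, Forest.leaves, List.mem_cons, forall_eq_or_imp] at hf hg
        rw [ih hf.2 hg.2 h1.2, (List.idxOf_inj hf.1).1 h1.1]
      | node u c g =>
        have h' : 2 * Nat.pair (w.idxOf j) (code f) + 1 = 2 * Nat.pair (code c) (code g) + 2 := h
        omega
    | node u c f ihc ihf =>
      cases g with
      | nil => simp [code] at h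
      | leaf j g =>
        have h' : 2 * Nat.pair (code c) (code f) + 2 = 2 * Nat.pair (w.idxOf j) (code g) + 1 := h
        omega
      | node u' c' g =>
        have h' : 2 * Nat.pair (code c) (code f) + 2 = 2 * Nat.pair (code c') (code g) + 2 := h
        have h1 : Nat.pair (code c) (code f) = Nat.pair (code c') (code g) := by omega
        rw [Nat.pair_eq_pair] at h1
        simp only [Set.mem_ofPred_eq, Forest.leaves, List.mem_append] at hf hg
        rw [ihc (fun j hj => hf j (.inl hj)) (fun j hj => hg j (.inl hj)) h1.1,
          ihf (fun j hj => hf j (.inr hj)) (fun j hj => hg j (.inr hj)) h1.2]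
  refine Set.Countable.mono (fun f hf => ?_)
    (Set.MapsTo.countable_of_injOn (Set.mapsTo_univ _ _) hc Set.countable_univ)
  intro j hj
  rwa [← show f.leaves = w from hf]

/-- A vertex with a single child, iterated. -/
def nodePow : ℕ → Forest Unit E → Forest Unit E
  | 0, f => f
  | p + 1, f => .node () (nodePow p f) .nil

lemma leaves_nodePow (p : ℕ) (f : Forest Unit E) : (nodePow p f).leaves = f.leaves := by
  induction p with
  | zero => rfl
  | succ p ih => simp [nodePow, Forest.leaves, ih]

/-- The forest consists of a single vertex with its children. -/
def IsNode (f : Forest Unit E) : Prop := ∃ c, f = .node () c .nil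

lemma exists_nodePow (f : Forest Unit E) : ∃ p g, ¬ IsNode g ∧ nodePow p g = f := by
  induction f with
  | nil => exact ⟨0, .nil, by simp [IsNode], rfl⟩
  | leaf j f => exact ⟨0, .leaf j f, by simp [IsNode], rfl⟩
  | node u c f ihc =>
    cases f with
    | nil =>
      obtain ⟨p, g, hg, rfl⟩ := ihc
      exact ⟨p + 1, g, hg, rfl⟩
    | leaf j f => exact ⟨0, .node u c (.leaf j f), by simp [IsNode], rfl⟩
    | node u' c' f => exact ⟨0, .node u c (.node u' c' f), by simp [IsNode], rfl⟩

/-- Stripping the maximal chain of single-child vertices reaches every forest; surjectivity is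
enough for the inequality. -/
lemma tsum_le_tsum_nodePow (φ : Forest Unit E → ℝ≥0∞) :
    ∑' f, φ f ≤ ∑' (p : ℕ) (g : Forest Unit E), if IsNode g then 0 else φ (nodePow p g) := by
  have hs : Function.Surjective fun x : ℕ × {g : Forest Unit E // ¬ IsNode g} =>
      nodePow x.1 x.2.1 := by
    intro f
    obtain ⟨p, g, hg, h⟩ := exists_nodePow f
    exact ⟨(p, ⟨g, hg⟩), h⟩
  refine (ENNReal.tsum_le_tsum_comp_of_surjective hs φ).trans ?_
  rw [ENNReal.tsum_prod (f := fun (p : ℕ) (g : {g : Forest Unit E // ¬ IsNode g}) =>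
    φ (nodePow p g.1))]
  refine ENNReal.tsum_le_tsum fun p => ?_
  refine le_trans (le_of_eq ?_) (ENNReal.tsum_comp_le_tsum_of_injective
    (f := fun g : {g : Forest Unit E // ¬ IsNode g} => g.1) Subtype.val_injective _)
  exact tsum_congr fun g => by rw [if_neg g.2]

/-! ### Bounds for sums over shapes -/

/-- A multiplicative bound for the amplitude of a forest, given a bound `C` for the leaves and
bounds `b` for the trees. -/
def forestBound (N C : ℝ≥0∞) (b : Forest Unit E → ℝ≥0∞) : Forest Unit E → ℝ≥0∞
  | .nil => N
  | .leaf _ f => C * forestBound N C b f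
  | .node _ c f => b c * forestBound N C b f

/-- The bound for a single tree. -/
def treeBound (C : ℝ≥0∞) (b : Forest Unit E → ℝ≥0∞) : E ⊕ Forest Unit E → ℝ≥0∞
  | .inl _ => C
  | .inr c => b c

variable {N C : ℝ≥0∞} {b : Forest Unit E → ℝ≥0∞}

lemma forestBound_consTree (x : (E ⊕ Forest Unit E) × Forest Unit E) :
    forestBound N C b (consTree x) = treeBound C b x.1 * forestBound N C b x.2 := by
  obtain ⟨j | c, f⟩ := x <;> rfl

lemma tsum_singleton_le (u : List E) (c : ℝ≥0∞) : (∑' j : E, if [j] = u then c else 0) ≤ c := by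
  by_cases h : ∃ j, u = [j]
  · obtain ⟨j, rfl⟩ := h
    simp only [List.cons.injEq, and_true]
    rw [tsum_ite_eq]
  · rw [ENNReal.tsum_eq_zero.2 fun j => if_neg fun h' => h ⟨j, h'.symm⟩]
    exact zero_le

lemma tsum_treeBound_le (u : List E) :
    (∑' t : E ⊕ Forest Unit E, if treeLeaves t = u then treeBound C b t else 0) ≤
      C + ∑' f : Forest Unit E, if f.leaves = u then b f else 0 := by
  rw [Summable.tsum_sum ENNReal.summable ENNReal.summable]
  exact add_le_add (tsum_singleton_le u C) le_rfl

variable (hb : ∀ f : Forest Unit E, f.leaves = [] → b f = 0)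

include hb

lemma tsum_treeBound_nil :
    (∑' t : E ⊕ Forest Unit E, if treeLeaves t = [] then treeBound C b t else 0) = 0 := by
  refine ENNReal.tsum_eq_zero.2 fun t => ?_
  obtain j | c := t
  · simp [treeLeaves]
  · split_ifs with h
    · exact hb c h
    · rfl

/-- A first tree without leaves has bound zero, so the first tree takes at least one letter and the
remaining forest has a shorter word. -/
lemma forestBound_ne_top (hC : C ≠ ∞) (hN : N ≠ ∞) (w : List E)
    (h : ∀ u : List E, u.length ≤ w.length →
      (∑' f : Forest Unit E, if f.leaves = u then b f else 0) ≠ ∞) :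
    (∑' f : Forest Unit E, if f.leaves = w then forestBound N C b f else 0) ≠ ∞ := by
  induction hn : w.length using Nat.strong_induction_on generalizing w with
  | _ n ih =>
    subst hn
    rw [tsum_forest]
    refine ENNReal.add_ne_top.2 ⟨by split_ifs <;> simp [forestBound, hN], ?_⟩
    simp_rw [leaves_consTree, forestBound_consTree]
    rw [tsum_mul_ite_append, ENNReal.sum_ne_top]
    intro k hk
    rw [Finset.mem_range] at hk
    rcases Nat.eq_zero_or_pos k with rfl | hk0
    · rw [List.take_zero, tsum_treeBound_nil hb, zero_mul]; simp
    · refine ENNReal.mul_ne_top ?_ ?_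
      · refine ne_top_of_le_ne_top (ENNReal.add_ne_top.2 ⟨hC, h (w.take k) ?_⟩)
          (tsum_treeBound_le _)
        simp
      · exact ih _ (by simp; omega) (w.drop k) (fun u hu => h u (by simp at hu; omega)) rfl

/-- Strictly shorter words suffice here: a first vertex that owns all of `w` is followed either by
trees without leaves, which have bound zero, or by nothing, which is the excluded case. -/
lemma forestBound_not_isNode_ne_top (hC : C ≠ ∞) (hN : N ≠ ∞) (w : List E)
    (h : ∀ u : List E, u.length < w.length →
      (∑' f : Forest Unit E, if f.leaves = u then b f else 0) ≠ ∞) :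
    (∑' f : Forest Unit E, if f.leaves = w ∧ ¬ IsNode f then forestBound N C b f else 0) ≠ ∞ := by
  have hnil : (∑' f : Forest Unit E, if f.leaves = [] then forestBound N C b f else 0) ≠ ∞ := by
    refine forestBound_ne_top hb hC hN [] fun u hu => ?_
    rw [ENNReal.tsum_eq_zero.2 fun f => ?_]
    · simp
    · split_ifs with h
      · exact hb f (by simpa [h] using hu)
      · rfl
  rw [tsum_forest]
  refine ENNReal.add_ne_top.2 ⟨by split_ifs <;> simp [forestBound, hN], ?_⟩
  -- The cut at the end of `w` is separated. Only a leaf survives there as first tree, hence the `0`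
  -- in place of `b`.
  have hle : ∀ x : (E ⊕ Forest Unit E) × Forest Unit E,
      (if (consTree x).leaves = w ∧ ¬ IsNode (consTree x) then forestBound N C b (consTree x)
        else 0) ≤
      (∑ k ∈ Finset.range w.length, (if treeLeaves x.1 = w.take k then treeBound C b x.1 else 0) *
        (if x.2.leaves = w.drop k then forestBound N C b x.2 else 0)) +
      (if treeLeaves x.1 = w then treeBound C 0 x.1 else 0) *
        (if x.2.leaves = [] then forestBound N C b x.2 else 0) := by
    intro x
    have e := ite_append_eq (treeLeaves x.1) x.2.leaves w (treeBound C b x.1)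
      (forestBound N C b x.2)
    rw [Finset.sum_range_succ, List.take_length, List.drop_length] at e
    by_cases hx : (consTree x).leaves = w ∧ ¬ IsNode (consTree x)
    · rw [if_pos hx, forestBound_consTree]
      rw [if_pos (by rw [← leaves_consTree]; exact hx.1)] at e
      rw [e]
      refine add_le_add le_rfl ?_
      obtain ⟨j | c, f⟩ := x
      · exact le_rfl
      · refine le_of_eq_of_le ?_ (zero_le)
        split_ifs with h1 h2
        · have : forestBound N C b f = 0 := by
            cases f with
            | nil => exact absurd ⟨c, rfl⟩ hx.2
            | leaf j f => simp [Forest.leaves] at h2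
            | node u c' f =>
              simp only [Forest.leaves, List.append_eq_nil_iff] at h2
              simp [forestBound, hb c' h2.1]
          rw [this, mul_zero]
        · simp
        · simp
        · simp
    · rw [if_neg hx]; exact zero_le
  refine ne_top_of_le_ne_top ?_ (ENNReal.tsum_le_tsum hle)
  rw [ENNReal.tsum_add, Summable.tsum_finsetSum fun _ _ => ENNReal.summable]
  have hsplit : ∀ (β : E ⊕ Forest Unit E → ℝ≥0∞) (κ : Forest Unit E → ℝ≥0∞),
      ∑' x : (E ⊕ Forest Unit E) × Forest Unit E, β x.1 * κ x.2 = (∑' t, β t) * ∑' f, κ f := by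
    intro β κ
    rw [ENNReal.tsum_prod (f := fun t f => β t * κ f)]
    simp_rw [ENNReal.tsum_mul_left, ENNReal.tsum_mul_right]
  refine ENNReal.add_ne_top.2 ⟨?_, ?_⟩
  · rw [ENNReal.sum_ne_top]
    intro k hk
    rw [Finset.mem_range] at hk
    rw [hsplit (fun t => if treeLeaves t = w.take k then treeBound C b t else 0)
      (fun f => if f.leaves = w.drop k then forestBound N C b f else 0)]
    rcases Nat.eq_zero_or_pos k with rfl | hk0
    · rw [List.take_zero, tsum_treeBound_nil hb, zero_mul]; simp
    · refine ENNReal.mul_ne_top ?_ ?_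
      · refine ne_top_of_le_ne_top (ENNReal.add_ne_top.2 ⟨hC, h (w.take k) ?_⟩)
          (tsum_treeBound_le _)
        simp; omega
      · exact forestBound_ne_top hb hC hN _ fun u hu => h u (by simp at hu; omega)
  · rw [hsplit (fun t => if treeLeaves t = w then treeBound C 0 t else 0)
      (fun f => if f.leaves = [] then forestBound N C b f else 0)]
    refine ENNReal.mul_ne_top (ne_top_of_le_ne_top ?_ (tsum_treeBound_le w)) hnil
    simp [hC]

end Shapes

/-! ### Vanishing amplitudes -/

section Vanishing

variable {E A : Type*} [MeasurableSpace E] {μ : Measure E} [SigmaFinite μ]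
  [NormedCommRing A] [NormedAlgebra ℝ A] [CompleteSpace A] {G : E → E → A} {AI : List E → A}

lemma forestAmp_of_length_ne {L : Type*} (f : Forest L E) (ys : List E)
    (h : ys.length ≠ f.width) : forestAmp μ G AI f ys = 0 := by
  induction f generalizing ys with
  | nil => cases ys <;> simp_all [forestAmp, Forest.width]
  | leaf j f ih =>
    cases ys with
    | nil => rfl
    | cons y ys => simp [forestAmp, ih ys (by simpa [Forest.width] using h)]
  | node i c f _ ih =>
    cases ys with
    | nil => rfl
    | cons y ys => simp [forestAmp_node, ih ys (by simpa [Forest.width] using h)]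

lemma treeAmp_eq_zero {L : Type*} {f : Forest L E} (h : ∀ ys, forestAmp μ G AI f ys = 0)
    (y : E) : treeAmp μ G AI f y = 0 := by
  simp [treeAmp, vertexAmp, h]

variable (hTadpole : ∀ j, onePI μ G AI [j] = 0)

include hTadpole

lemma integral_tadpole (y : E) : ∫ l, G y l * AI [l] ∂μ = 0 := hTadpole y

lemma treeAmp_nil {L : Type*} (y : E) : treeAmp μ G AI (.nil : Forest L E) y = 0 := by
  refine Eq.trans ?_ (integral_tadpole hTadpole y)
  refine integral_congr_ae (.of_forall fun l => ?_)
  change G y l * ∫ v : Fin 0 → E, AI (l :: List.ofFn v) * forestAmp μ G AI .nil (List.ofFn v)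
    ∂(Measure.pi fun _ => μ) = _
  rw [Measure.pi_of_empty (x := Fin.elim0), integral_dirac]
  simp [forestAmp]

/-- Going up through first children of a tree without leaves ends at a childless vertex, a tadpole,
and its zero propagates down. -/
lemma treeAmp_of_leaves_eq_nil {L : Type*} (f : Forest L E) (h : f.leaves = []) (y : E) :
    treeAmp μ G AI f y = 0 := by
  induction f generalizing y with
  | nil => exact treeAmp_nil hTadpole y
  | leaf j f ih => simp [Forest.leaves] at h
  | node i c f ih _ =>
    simp only [Forest.leaves, List.append_eq_nil_iff] at h
    refine treeAmp_eq_zero (fun ys => ?_) y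
    cases ys with
    | nil => rfl
    | cons y ys => rw [forestAmp_node, ih h.1, zero_mul]

/-- A childless vertex is a tadpole. This allows sums over all shapes, whereas decreasing trees have
proper ones only. -/
lemma forestAmp_of_not_proper {L : Type*} (f : Forest L E) (h : ¬ f.Proper) (ys : List E) :
    forestAmp μ G AI f ys = 0 := by
  induction f generalizing ys with
  | nil => exact absurd trivial h
  | leaf j f ih =>
    cases ys with
    | nil => rfl
    | cons y ys => simp [forestAmp, ih h]
  | node i c f ihc ihf =>
    cases ys with
    | nil => rfl
    | cons y ys =>
      rw [forestAmp_node]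
      by_cases hc : c = .nil
      · rw [hc, treeAmp_nil hTadpole, zero_mul]
      by_cases hp : c.Proper
      · rw [ihf fun hf => h ⟨hc, hp, hf⟩, mul_zero]
      · rw [treeAmp_eq_zero (ihc hp), zero_mul]

/-- Some tree of the forest then has no leaf. This is what truncates the number of children at the
length of the word. -/
lemma forestAmp_of_leaves_lt_width {L : Type*} (f : Forest L E) (h : f.leaves.length < f.width)
    (ys : List E) : forestAmp μ G AI f ys = 0 := by
  induction f generalizing ys with
  | nil => simp [Forest.width] at h
  | leaf j f ih =>
    cases ys with
    | nil => rfl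
    | cons y ys =>
      simp only [Forest.leaves, Forest.width, List.length_cons] at h
      simp [forestAmp, ih (by omega)]
  | node i c f _ ih =>
    cases ys with
    | nil => rfl
    | cons y ys =>
      simp only [Forest.leaves, Forest.width, List.length_append] at h
      rw [forestAmp_node]
      by_cases hc : c.leaves = []
      · rw [treeAmp_of_leaves_eq_nil hTadpole c hc, zero_mul]
      · have := List.length_pos_of_ne_nil hc
        rw [ih (by omega), mul_zero]

end Vanishing

/-! ### Chains of self-energies -/

section Chains

universe u

variable {E : Type u} {A : Type*} [MeasurableSpace E] {μ : Measure E} [SigmaFinite μ]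
  [NormedCommRing A] [NormedAlgebra ℝ A] [CompleteSpace A] {G : E → E → A} {AI : List E → A}

namespace IsRegular

variable (hr : IsRegular μ G AI)

include hr

lemma integrable_AI_pair : Integrable (fun y : E × E => AI [y.1, y.2]) (μ.prod μ) := by
  have h := (measurePreserving_finTwoArrow μ).symm.integrable_comp_of_integrable (hr.int 2)
  refine h.congr (.of_forall fun y => ?_)
  simp [MeasurableEquiv.finTwoArrow, MeasurableEquiv.piFinTwo]

lemma stronglyMeasurable_chain (p : ℕ) :
    StronglyMeasurable (Function.uncurry (chain μ G AI p)) := by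
  induction p with
  | zero => exact hr.meas
  | succ p ih =>
    have h1 : StronglyMeasurable (Function.uncurry fun (x : E × E) (y : E × E) =>
        G x.1 y.1 * chain μ G AI p y.2 x.2) :=
      (hr.meas.comp_measurable (g := fun q : (E × E) × (E × E) => (q.1.1, q.2.1))
        (by fun_prop)).mul
      (ih.comp_measurable (g := fun q : (E × E) × (E × E) => (q.2.2, q.1.2)) (by fun_prop))
    have h2 := stronglyMeasurable_integral_mul h1 hr.integrable_AI_pair.aestronglyMeasurable
    convert h2 using 1
    funext ⟨i, j⟩
    simp only [Function.uncurry, chain]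
    congr 1
    funext y
    ring

/-- Applying the propagator and the self-energy to a chain lengthens the chain. -/
lemma integral_chain_succ {p : ℕ} {D : ℝ} (hD : ∀ i j, ‖chain μ G AI p i j‖ ≤ D)
    {g : E → A} (hg : Integrable g μ) (i : E) :
    ∫ y : E × E, G i y.1 * (AI [y.1, y.2] * ∫ l, chain μ G AI p y.2 l * g l ∂μ) ∂(μ.prod μ) =
      ∫ l, chain μ G AI (p + 1) i l * g l ∂μ := by
  obtain ⟨C, hC⟩ := hr.bdd
  have hbd : ∀ (y : E × E) (l : E), ‖G i y.1 * chain μ G AI p y.2 l‖ ≤ C * D := fun y l =>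
    (norm_mul_le _ _).trans
      (mul_le_mul (hC _ _) (hD _ _) (norm_nonneg _) ((norm_nonneg _).trans (hC i i)))
  have hms : StronglyMeasurable fun q : (E × E) × E => G i q.1.1 * chain μ G AI p q.1.2 q.2 :=
    ((hr.stronglyMeasurable_G_left i).comp_measurable (by fun_prop)).mul
      ((hr.stronglyMeasurable_chain p).comp_measurable
        (g := fun q : (E × E) × E => (q.1.2, q.2)) (by fun_prop))
  have hint : Integrable (fun q : (E × E) × E => G i q.1.1 * chain μ G AI p q.1.2 q.2 *
      (AI [q.1.1, q.1.2] * g q.2)) ((μ.prod μ).prod μ) :=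
    (hr.integrable_AI_pair.mul_prod hg).bdd_mul hms.aestronglyMeasurable
      (.of_forall fun q => hbd q.1 q.2)
  have e1 : ∀ y : E × E, G i y.1 * (AI [y.1, y.2] * ∫ l, chain μ G AI p y.2 l * g l ∂μ) =
      ∫ l, G i y.1 * chain μ G AI p y.2 l * (AI [y.1, y.2] * g l) ∂μ := by
    intro y
    have hi : Integrable (fun l => chain μ G AI p y.2 l * g l) μ :=
      hg.bdd_mul ((hr.stronglyMeasurable_chain p).comp_measurable
        measurable_prodMk_left).aestronglyMeasurable (.of_forall fun l => hD _ _)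
    rw [← mul_assoc, ← integral_const_mul_of_integrable hi]
    exact integral_congr_ae (.of_forall fun l => by simp only; ring)
  have e2 : ∀ l, ∫ y : E × E, G i y.1 * chain μ G AI p y.2 l * (AI [y.1, y.2] * g l) ∂(μ.prod μ) =
      chain μ G AI (p + 1) i l * g l := by
    intro l
    have hi : Integrable (fun y : E × E => G i y.1 * AI [y.1, y.2] * chain μ G AI p y.2 l)
        (μ.prod μ) := by
      refine (hr.integrable_AI_pair.bdd_mul (c := C * D)
        (f := fun y : E × E => G i y.1 * chain μ G AI p y.2 l) ?_
        (.of_forall fun y => hbd y l)).congr (.of_forall fun y => by simp only; ring)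
      exact (hms.comp_measurable (g := fun y : E × E => (y, l)) (by fun_prop)).aestronglyMeasurable
    rw [chain, ← integral_mul_const_of_integrable hi]
    exact integral_congr_ae (.of_forall fun y => by simp only; ring)
  simp_rw [e1, ← e2]
  exact integral_integral_swap hint

/-- The one-particle reducible part of the Legendre relation as an integral over pairs. -/
lemma integral_pair_eq {u : E → A} (hu : StronglyMeasurable u) {D : ℝ} (hD : ∀ y, ‖u y‖ ≤ D)
    (i : E) : ∫ y : E × E, G i y.1 * (AI [y.1, y.2] * u y.2) ∂(μ.prod μ) =
      ∫ l, G i l * ∫ y, AI [l, y] * u y ∂μ ∂μ := by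
  obtain ⟨C, hC⟩ := hr.bdd
  have h1 : Integrable (fun y : E × E => AI [y.1, y.2] * u y.2) (μ.prod μ) :=
    hr.integrable_AI_pair.mul_bdd (c := D)
      (hu.comp_measurable measurable_snd).aestronglyMeasurable (.of_forall fun y => hD _)
  have h2 : Integrable (fun y : E × E => G i y.1 * (AI [y.1, y.2] * u y.2)) (μ.prod μ) :=
    h1.bdd_mul ((hr.stronglyMeasurable_G_left i).comp_measurable
      measurable_fst).aestronglyMeasurable (.of_forall fun y => hC _ _)
  rw [integral_prod _ h2]
  refine integral_congr_ae ?_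
  filter_upwards [h1.prod_right_ae] with l hl
  exact integral_const_mul_of_integrable hl

lemma treeAmp_node_nil {L : Type*} (k : L) (c : Forest L E) (i : E) :
    treeAmp μ G AI (.node k c .nil) i =
      ∫ y : E × E, G i y.1 * (AI [y.1, y.2] * treeAmp μ G AI c y.2) ∂(μ.prod μ) := by
  obtain ⟨D, hD⟩ := hr.bdd_treeAmp c
  rw [hr.integral_pair_eq (hr.stronglyMeasurable_treeAmp c) hD, treeAmp]
  congr 1
  funext l
  congr 1
  rw [← (measurePreserving_funUnique μ (Fin 1)).integral_comp']
  change ∫ v : Fin 1 → E, AI (l :: List.ofFn v) *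
    forestAmp μ G AI (.node k c .nil) (List.ofFn v) ∂_ = _
  congr 1
  funext v
  simp [forestAmp_node, forestAmp, MeasurableEquiv.funUnique]

variable {c : ℕ → ℝ} (hc : ∀ p i j, ‖chain μ G AI p i j‖ ≤ c p)

include hc

lemma treeAmp_nodePow (p : ℕ) (f : Forest Unit E) (i : E) :
    treeAmp μ G AI (nodePow p f) i =
      ∫ l, chain μ G AI p i l * vertexAmp μ G AI f l ∂μ := by
  induction p generalizing i with
  | zero => rfl
  | succ p ih =>
    rw [nodePow, hr.treeAmp_node_nil]
    simp_rw [ih]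
    exact hr.integral_chain_succ (hc p) (hr.integrable_vertexAmp f) i

/-- A bounded solution of the homogeneous linear equation vanishes. -/
lemma eq_zero_of_eq_integral (hsum : Summable c) {u : E → A} (hu : StronglyMeasurable u) {D : ℝ}
    (hD : ∀ y, ‖u y‖ ≤ D)
    (h : ∀ i, u i = ∫ y : E × E, G i y.1 * (AI [y.1, y.2] * u y.2) ∂(μ.prod μ)) (i : E) :
    u i = 0 := by
  have h1 : Integrable (fun y : E × E => AI [y.1, y.2] * u y.2) (μ.prod μ) :=
    hr.integrable_AI_pair.mul_bdd (c := D)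
      (hu.comp_measurable measurable_snd).aestronglyMeasurable (.of_forall fun y => hD _)
  have hg := h1.integral_prod_left
  -- The equation is substituted into itself `p` times.
  have hp : ∀ p i, u i = ∫ l, chain μ G AI p i l * ∫ y, AI [l, y] * u y ∂μ ∂μ := by
    intro p
    induction p with
    | zero => intro i; rw [h, hr.integral_pair_eq hu hD]; rfl
    | succ p ih =>
      intro i
      rw [← hr.integral_chain_succ (hc p) hg, h]
      congr 1
      funext y
      rw [← ih]
  have hle : ∀ p, ‖u i‖ ≤ c p * ∫ l, ‖∫ y, AI [l, y] * u y ∂μ‖ ∂μ := fun p => by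
    conv_lhs => rw [hp p i]
    exact norm_integral_mul_le hg (hc p i)
  have hlim : Filter.Tendsto (fun p => c p * ∫ l, ‖∫ y, AI [l, y] * u y ∂μ‖ ∂μ) Filter.atTop
      (nhds 0) := by
    simpa using hsum.tendsto_atTop_zero.mul_const (∫ l, ‖∫ y, AI [l, y] * u y ∂μ‖ ∂μ)
  have := ge_of_tendsto' hlim hle
  exact norm_le_zero_iff.1 this

end IsRegular

end Chains

/-! ### Convergence of the sum over trees -/

section Convergence

open scoped ENNReal Classical

universe u

variable {E : Type u} {A : Type*} [MeasurableSpace E] {μ : Measure E} [SigmaFinite μ]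
  [NormedCommRing A] [NormedAlgebra ℝ A] [CompleteSpace A] {G : E → E → A} {AI : List E → A}

lemma enorm_mul_le_mul_enorm (a b : A) : ‖a * b‖ₑ ≤ ‖a‖ₑ * ‖b‖ₑ := by
  rw [← ofReal_norm, ← ofReal_norm, ← ofReal_norm, ← ENNReal.ofReal_mul (norm_nonneg a)]
  exact ENNReal.ofReal_le_ofReal (norm_mul_le a b)

variable (μ G AI) in
/-- The supremum norm of the amplitude of a tree. -/
def treeSup (f : Forest Unit E) : ℝ≥0∞ := ⨆ y, ‖treeAmp μ G AI f y‖ₑ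

variable (μ G AI) in
/-- A bound for the amplitude of a forest, the propagator being bounded by `C`. -/
def ampBound (C : ℝ) : Forest Unit E → ℝ≥0∞ :=
  forestBound ‖(1 : A)‖ₑ (ENNReal.ofReal C) (treeSup μ G AI)

lemma treeSup_of_leaves_eq_nil (hTadpole : ∀ j, onePI μ G AI [j] = 0) (f : Forest Unit E)
    (h : f.leaves = []) : treeSup μ G AI f = 0 := by
  simp [treeSup, treeAmp_of_leaves_eq_nil hTadpole f h]

lemma enorm_forestAmp_le {C : ℝ} (hC : ∀ x y, ‖G x y‖ ≤ C) (f : Forest Unit E) (ys : List E) :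
    ‖forestAmp μ G AI f ys‖ₑ ≤ ampBound μ G AI C f := by
  induction f generalizing ys with
  | nil => cases ys <;> simp [forestAmp, ampBound, forestBound]
  | leaf j f ih =>
    cases ys with
    | nil => simp [forestAmp]
    | cons y ys =>
      refine (enorm_mul_le_mul_enorm _ _).trans (mul_le_mul' ?_ (ih ys))
      rw [← ofReal_norm]
      exact ENNReal.ofReal_le_ofReal (hC y j)
  | node u c f _ ih =>
    cases ys with
    | nil => simp [forestAmp]
    | cons y ys =>
      exact (enorm_mul_le_mul_enorm _ _).trans (mul_le_mul' (le_iSup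
        (fun y => ‖treeAmp μ G AI c y‖ₑ) y) (ih ys))

lemma ampBound_eq_zero_of_leaves_lt_width (hTadpole : ∀ j, onePI μ G AI [j] = 0) (C : ℝ)
    (f : Forest Unit E) (h : f.leaves.length < f.width) : ampBound μ G AI C f = 0 := by
  unfold ampBound
  induction f with
  | nil => simp [Forest.width] at h
  | leaf j f ih =>
    simp only [Forest.leaves, Forest.width, List.length_cons] at h
    simp [forestBound, ih (by omega)]
  | node u c f _ ih =>
    simp only [Forest.leaves, Forest.width, List.length_append] at h
    by_cases hc : c.leaves = []
    · simp [forestBound, treeSup_of_leaves_eq_nil hTadpole c hc]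
    · have := List.length_pos_of_ne_nil hc
      simp [forestBound, ih (by omega)]

namespace IsRegular

variable (hr : IsRegular μ G AI)

include hr

lemma lintegral_vertexAmp_le {C : ℝ} (hC : ∀ x y, ‖G x y‖ ≤ C) (f : Forest Unit E) :
    ∫⁻ l, ‖vertexAmp μ G AI f l‖ₑ ∂μ ≤
      (∫⁻ p : E × (Fin f.width → E), ‖AI (p.1 :: List.ofFn p.2)‖ₑ
        ∂(μ.prod (Measure.pi fun _ => μ))) * ampBound μ G AI C f := by
  have hm := (hr.integrable_AI_cons f.width).aestronglyMeasurable.enorm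
  rw [← lintegral_mul_const'' _ hm, lintegral_prod _ (hm.mul_const _)]
  refine lintegral_mono fun l => (enorm_integral_le_lintegral_enorm _).trans
    (lintegral_mono fun v => (enorm_mul_le_mul_enorm _ _).trans ?_)
  exact mul_le_mul' le_rfl (enorm_forestAmp_le hC f _)

variable (hTadpole : ∀ j, onePI μ G AI [j] = 0)
  {c : ℕ → ℝ} (hc : ∀ p i j, ‖chain μ G AI p i j‖ ≤ c p) (hsum : Summable c)

include hTadpole hc hsum

/-- Strong induction on the number of leaves. A chain of length `p` costs `c p` times the `L¹` norm
of the vertex at its end; the children of that vertex do not form a single inner tree, so the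
induction hypothesis covers them through `forestBound_not_isNode_ne_top`. -/
lemma tsum_treeSup_ne_top (w : List E) :
    (∑' f : Forest Unit E, if f.leaves = w then treeSup μ G AI f else 0) ≠ ∞ := by
  obtain ⟨C, hC⟩ := hr.bdd
  induction hn : w.length using Nat.strong_induction_on generalizing w with
  | _ n ih =>
    subst hn
    have h1 := forestBound_not_isNode_ne_top (N := ‖(1 : A)‖ₑ) (C := ENNReal.ofReal C)
      (treeSup_of_leaves_eq_nil hTadpole) ENNReal.ofReal_ne_top enorm_ne_top w
      (fun u hu => ih u.length hu u rfl)
    -- A constant uniform in the shape: widths above the length of `w` need no term, as their bound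
    -- is zero.
    let M : ℝ≥0∞ := ∑ m ∈ Finset.range (w.length + 1), ∫⁻ p : E × (Fin m → E),
      ‖AI (p.1 :: List.ofFn p.2)‖ₑ ∂(μ.prod (Measure.pi fun _ => μ))
    have hM : M ≠ ∞ := by
      rw [ENNReal.sum_ne_top]
      exact fun m _ => (hr.integrable_AI_cons m).2.ne
    refine ne_top_of_le_ne_top (ENNReal.mul_ne_top hsum.tsum_ofReal_ne_top
      (ENNReal.mul_ne_top hM h1)) ((tsum_le_tsum_nodePow _).trans ?_)
    rw [← ENNReal.tsum_mul_left, ← ENNReal.tsum_mul_right]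
    refine ENNReal.tsum_le_tsum fun p => ?_
    rw [← ENNReal.tsum_mul_left]
    refine ENNReal.tsum_le_tsum fun f => ?_
    rw [leaves_nodePow]
    by_cases hf : IsNode f
    · simp [hf]
    by_cases hw : f.leaves = w
    · rw [if_neg hf, if_pos hw, if_pos ⟨hw, hf⟩]
      have h2 : treeSup μ G AI (nodePow p f) ≤
          ENNReal.ofReal (c p) * ∫⁻ l, ‖vertexAmp μ G AI f l‖ₑ ∂μ := by
        refine iSup_le fun i => ?_
        rw [hr.treeAmp_nodePow hc, ← lintegral_const_mul' _ _ ENNReal.ofReal_ne_top]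
        refine (enorm_integral_le_lintegral_enorm _).trans (lintegral_mono fun l => ?_)
        refine (enorm_mul_le_mul_enorm _ _).trans (mul_le_mul' ?_ le_rfl)
        rw [← ofReal_norm]
        exact ENNReal.ofReal_le_ofReal (hc p i l)
      refine h2.trans (mul_le_mul' le_rfl ((hr.lintegral_vertexAmp_le hC f).trans ?_))
      by_cases hl : f.leaves.length < f.width
      · rw [ampBound_eq_zero_of_leaves_lt_width hTadpole C f hl, mul_zero]
        exact zero_le
      · refine mul_le_mul' ?_ le_rfl
        refine Finset.single_le_sum (f := fun m => ∫⁻ p : E × (Fin m → E),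
          ‖AI (p.1 :: List.ofFn p.2)‖ₑ ∂(μ.prod (Measure.pi fun _ => μ)))
          (fun _ _ => zero_le) ?_
        rw [Finset.mem_range, ← hw]
        omega
    · simp [hw]

lemma tsum_ampBound_ne_top (C : ℝ) (w : List E) :
    (∑' f : Forest Unit E, if f.leaves = w then ampBound μ G AI C f else 0) ≠ ∞ :=
  forestBound_ne_top (treeSup_of_leaves_eq_nil hTadpole) ENNReal.ofReal_ne_top enorm_ne_top w
    fun u _ => hr.tsum_treeSup_ne_top hTadpole hc hsum u

omit hr hTadpole hc hsum in
lemma summable_norm_of_enorm_le {ι : Type*} {φ : ι → A} {κ : ι → ℝ≥0∞} (h : ∀ x, ‖φ x‖ₑ ≤ κ x)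
    (hκ : ∑' x, κ x ≠ ∞) : Summable fun x => ‖φ x‖ := by
  have := ENNReal.summable_toReal (ne_top_of_le_ne_top hκ (ENNReal.tsum_le_tsum h))
  simpa only [toReal_enorm] using this

lemma summable_norm_treeAmp (w : List E) (y : E) :
    Summable fun f : Forest Unit E => ‖if f.leaves = w then treeAmp μ G AI f y else 0‖ := by
  refine summable_norm_of_enorm_le (fun f => ?_) (hr.tsum_treeSup_ne_top hTadpole hc hsum w)
  split_ifs
  · exact le_iSup (fun y => ‖treeAmp μ G AI f y‖ₑ) y
  · simp

lemma summable_norm_forestAmp (w ys : List E) :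
    Summable fun f : Forest Unit E => ‖if f.leaves = w then forestAmp μ G AI f ys else 0‖ := by
  obtain ⟨C, hC⟩ := hr.bdd
  refine summable_norm_of_enorm_le (fun f => ?_) (hr.tsum_ampBound_ne_top hTadpole hc hsum C w)
  split_ifs
  · exact enorm_forestAmp_le hC f ys
  · simp

end IsRegular

/-! ### The sum over trees -/

variable (μ G AI) in
/-- The connected Green's functions as sums over trees. -/
def treeSeries (y : E) (w : List E) : A :=
  bare G (y :: w) + ∑' f : Forest Unit E, if f.leaves = w then treeAmp μ G AI f y else 0

/-- The amplitude of a leaf or of a vertex with its children. -/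
def treeValue (μ : Measure E) (G : E → E → A) (AI : List E → A) (y : E) :
    E ⊕ Forest Unit E → A
  | .inl j => G y j
  | .inr f => treeAmp μ G AI f y

lemma forestAmp_consTree (x : (E ⊕ Forest Unit E) × Forest Unit E) (y : E) (ys : List E) :
    forestAmp μ G AI (consTree x) (y :: ys) =
      treeValue μ G AI y x.1 * forestAmp μ G AI x.2 ys := by
  obtain ⟨j | f, g⟩ := x <;> rfl

lemma hasSum_bare (y : E) (w : List E) :
    HasSum (fun j : E => if [j] = w then G y j else 0) (bare G (y :: w)) := by
  match w with
  | [] => simp [bare]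
  | [l] =>
    simp only [List.cons.injEq, and_true, bare]
    exact hasSum_ite_eq l (G y l) |>.congr_fun (fun j => by split_ifs with h <;> simp [h])
  | _ :: _ :: _ => simp [bare]

end Convergence

/-! ### Products of series -/

section Series

variable {E A : Type*} [NormedCommRing A]

lemma seriesProd_singleton (f : List E → A) (w : List E) : seriesProd [f] w = f w := by
  rw [seriesProd, seriesMul, Finset.sum_eq_single w.length]
  · simp [seriesProd]
  · intro k hk hne
    rw [Finset.mem_range] at hk
    simp only [seriesProd, List.length_drop]
    rw [if_neg (by omega), mul_zero]
  · simp

lemma seriesProd_map_congr {φ ψ : E → List E → A} {n : ℕ}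
    (h : ∀ y u, u.length ≤ n → φ y u = ψ y u) (ys w : List E) (hw : w.length ≤ n) :
    seriesProd (ys.map φ) w = seriesProd (ys.map ψ) w := by
  induction ys generalizing w with
  | nil => rfl
  | cons y ys ih =>
    simp only [List.map_cons, seriesProd, seriesMul]
    refine Finset.sum_congr rfl fun k _ => ?_
    rw [h y _ (by simp; omega), ih _ (by simp; omega)]

/-- Without constant terms, a product of at least two series involves only the coefficients at
shorter words. -/
lemma seriesProd_map_congr_of_lt {φ ψ : E → List E → A} {w : List E}
    (hφ : ∀ y, φ y [] = 0) (hψ : ∀ y, ψ y [] = 0)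
    (h : ∀ y u, u.length < w.length → φ y u = ψ y u) (ys : List E) (hys : ys.length ≠ 1) :
    seriesProd (ys.map φ) w = seriesProd (ys.map ψ) w := by
  match ys, hys with
  | [], _ => rfl
  | y :: y' :: ys, _ =>
    have hnil : ∀ {χ : E → List E → A}, (∀ y, χ y [] = 0) →
        seriesProd ((y' :: ys).map χ) [] = 0 := by
      intro χ hχ
      simp [seriesProd, seriesMul, hχ]
    change seriesMul (φ y) (seriesProd ((y' :: ys).map φ)) w =
      seriesMul (ψ y) (seriesProd ((y' :: ys).map ψ)) w
    simp only [seriesMul]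
    refine Finset.sum_congr rfl fun k hk => ?_
    rw [Finset.mem_range] at hk
    rcases Nat.eq_zero_or_pos k with rfl | hk0
    · simp [hφ, hψ]
    rcases Nat.lt_or_ge k w.length with hlt | hge
    · rw [h y _ (by simp; omega),
        seriesProd_map_congr (n := w.length - 1) (fun y u hu => h y u (by omega)) _ _
          (by simp; omega)]
    -- If the first factor takes the whole word, at least one further factor is evaluated at the
    -- empty word.
    · rw [List.drop_of_length_le hge, hnil hφ, hnil hψ, mul_zero, mul_zero]

lemma seriesProd_map_regular [MeasurableSpace E] {φ : E → List E → A}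
    (hm : ∀ u, StronglyMeasurable fun y => φ y u) (hb : ∀ u, ∃ D, ∀ y, ‖φ y u‖ ≤ D) (m : ℕ)
    (w : List E) :
    (StronglyMeasurable fun v : Fin m → E => seriesProd ((List.ofFn v).map φ) w) ∧
      ∃ D, ∀ v : Fin m → E, ‖seriesProd ((List.ofFn v).map φ) w‖ ≤ D := by
  induction m generalizing w with
  | zero =>
    simp only [List.ofFn_zero, List.map_nil]
    exact ⟨stronglyMeasurable_const, _, fun _ => le_rfl⟩
  | succ m ih =>
    simp only [List.ofFn_succ, List.map_cons, seriesProd, seriesMul]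
    constructor
    · refine Finset.stronglyMeasurable_fun_sum _ fun k _ => ?_
      exact ((hm _).comp_measurable (measurable_pi_apply 0)).mul ((ih _).1.comp_measurable
        (measurable_pi_lambda _ fun i => measurable_pi_apply _))
    · choose D hD using hb
      choose D' hD' using fun w => (ih w).2
      refine ⟨∑ k ∈ Finset.range (w.length + 1), |D (w.take k)| * |D' (w.drop k)|, fun v => ?_⟩
      refine (norm_sum_le _ _).trans (Finset.sum_le_sum fun k _ => (norm_mul_le _ _).trans ?_)
      exact mul_le_mul ((hD _ _).trans (le_abs_self _)) ((hD' _ _).trans (le_abs_self _))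
        (norm_nonneg _) (abs_nonneg _)

end Series

/-! ### The Legendre relation for sums over trees, and its uniqueness -/

section Expansion

open scoped ENNReal Classical

universe u

variable {E : Type u} {A : Type*} [MeasurableSpace E] {μ : Measure E} [SigmaFinite μ]
  [NormedCommRing A] [NormedAlgebra ℝ A] [CompleteSpace A] {G : E → E → A} {AI W : List E → A}

lemma hasSum_mul_of_summable_norm {ι κ : Type*} {f : ι → A} {g : κ → A} {a b : A}
    (hf : HasSum f a) (hg : HasSum g b) (hf' : Summable fun x => ‖f x‖)
    (hg' : Summable fun x => ‖g x‖) : HasSum (fun x : ι × κ => f x.1 * g x.2) (a * b) :=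
  hf.mul hg (summable_mul_of_summable_norm hf' hg')

lemma indicator_leaves {M : Type*} [Zero M] (w : List E) (φ : Forest Unit E → M) :
    {f : Forest Unit E | f.leaves = w}.indicator φ =
      fun f => if f.leaves = w then φ f else 0 := by
  funext f
  simp [Set.indicator_apply]

lemma tsum_leaves {M : Type*} [AddCommMonoid M] [TopologicalSpace M] (w : List E)
    (φ : Forest Unit E → M) : (∑' f : Forest Unit E, if f.leaves = w then φ f else 0) =
      ∑' f : {f : Forest Unit E | f.leaves = w}, φ f := by
  rw [tsum_subtype, indicator_leaves]

namespace IsRegular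

variable (hr : IsRegular μ G AI)

include hr

lemma integrable_vertex_mul (i : E) {m : ℕ} {φ : (Fin m → E) → A} (hm : StronglyMeasurable φ)
    (hb : ∃ D, ∀ v, ‖φ v‖ ≤ D) :
    Integrable (fun p : E × (Fin m → E) => G i p.1 * (AI (p.1 :: List.ofFn p.2) * φ p.2))
      (μ.prod (Measure.pi fun _ => μ)) := by
  obtain ⟨C, hC⟩ := hr.bdd
  obtain ⟨D, hD⟩ := hb
  exact ((hr.integrable_AI_cons m).mul_bdd (c := D)
    (hm.comp_measurable measurable_snd).aestronglyMeasurable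
    (.of_forall fun p => hD _)).bdd_mul ((hr.stronglyMeasurable_G_left i).comp_measurable
      measurable_fst).aestronglyMeasurable (.of_forall fun p => hC _ _)

lemma integral_vertex_mul (i : E) {m : ℕ} {φ : (Fin m → E) → A} (hm : StronglyMeasurable φ)
    (hb : ∃ D, ∀ v, ‖φ v‖ ≤ D) :
    ∫ p : E × (Fin m → E), G i p.1 * (AI (p.1 :: List.ofFn p.2) * φ p.2)
      ∂(μ.prod (Measure.pi fun _ => μ)) =
    ∫ l, G i l * ∫ v : Fin m → E, AI (l :: List.ofFn v) * φ v ∂(Measure.pi fun _ => μ) ∂μ := by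
  rw [integral_prod _ (hr.integrable_vertex_mul i hm hb)]
  obtain ⟨D, hD⟩ := hb
  have := (hr.integrable_AI_cons m).mul_bdd (c := D)
    (hm.comp_measurable measurable_snd).aestronglyMeasurable (.of_forall fun p => hD _)
  refine integral_congr_ae ?_
  filter_upwards [this.prod_right_ae] with l hl
  exact integral_const_mul_of_integrable hl

/-- The planar Legendre relation with the integrals combined. -/
lemma legendre_expansion (hL : IsPlanarLegendre μ G AI W)
    (hm : ∀ u, StronglyMeasurable fun y => field W y u) (hb : ∀ u, ∃ D, ∀ y, ‖field W y u‖ ≤ D)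
    (i : E) (w : List E) :
    field W i w = bare G (i :: w) + ∑ m ∈ Finset.range (w.length + 1),
      ∫ p : E × (Fin m → E), G i p.1 *
        (AI (p.1 :: List.ofFn p.2) * seriesProd ((List.ofFn p.2).map (field W)) w)
        ∂(μ.prod (Measure.pi fun _ => μ)) := by
  rw [hL i w]
  congr 1
  obtain ⟨C, hC⟩ := hr.bdd
  have hreg := fun m => seriesProd_map_regular hm hb m w
  have hint : ∀ m, Integrable (fun l => ∫ v : Fin m → E, AI (l :: List.ofFn v) *
      seriesProd ((List.ofFn v).map (field W)) w ∂(Measure.pi fun _ => μ)) μ := by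
    intro m
    obtain ⟨D, hD⟩ := (hreg m).2
    exact ((hr.integrable_AI_cons m).mul_bdd (c := D)
      ((hreg m).1.comp_measurable measurable_snd).aestronglyMeasurable
      (.of_forall fun p => hD _)).integral_prod_left
  simp_rw [fun m => hr.integral_vertex_mul i (hreg m).1 (hreg m).2]
  rw [← integral_finsetSum _ fun m _ => (hint m).bdd_mul
    (hr.stronglyMeasurable_G_left i).aestronglyMeasurable (.of_forall fun l => hC i l)]
  refine integral_congr_ae (.of_forall fun l => ?_)
  simp only [interactionDeriv, Finset.mul_sum, List.map_ofFn, Function.comp_def]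

variable (hTadpole : ∀ j, onePI μ G AI [j] = 0)
  {c : ℕ → ℝ} (hc : ∀ p i j, ‖chain μ G AI p i j‖ ≤ c p) (hsum : Summable c)

include hTadpole in
lemma treeSeries_nil (y : E) : treeSeries μ G AI y [] = 0 := by
  rw [treeSeries, tsum_congr (g := fun _ => 0), tsum_zero, add_zero]
  · rfl
  · intro f
    split_ifs with h
    · exact treeAmp_of_leaves_eq_nil hTadpole f h y
    · rfl

include hTadpole hc hsum

lemma hasSum_treeValue (y : E) (w : List E) :
    HasSum (fun t => if treeLeaves t = w then treeValue μ G AI y t else 0)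
      (treeSeries μ G AI y w) :=
  HasSum.sum (hasSum_bare y w)
    (Summable.of_norm (hr.summable_norm_treeAmp hTadpole hc hsum w y)).hasSum

lemma summable_norm_treeValue (y : E) (w : List E) :
    Summable fun t => ‖if treeLeaves t = w then treeValue μ G AI y t else 0‖ := by
  refine Summable.sum _ ?_ (hr.summable_norm_treeAmp hTadpole hc hsum w y)
  refine (hasSum_bare (G := fun y j => ‖G y j‖) y w).summable.congr fun j => ?_
  by_cases h : [j] = w
  · have h' : treeLeaves (.inl j) = w := h
    simp only [Function.comp, if_pos h, if_pos h', treeValue]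
  · have h' : treeLeaves (.inl j) ≠ w := h
    simp only [Function.comp, if_neg h, if_neg h', norm_zero]

/-- The forests with given leaves sum up to a product of sums over trees. -/
lemma hasSum_forestAmp (ys w : List E) :
    HasSum (fun f : Forest Unit E => if f.leaves = w then forestAmp μ G AI f ys else 0)
      (seriesProd (ys.map (treeSeries μ G AI)) w) := by
  induction ys generalizing w with
  | nil =>
    have : seriesProd (([] : List E).map (treeSeries μ G AI)) w =
        if (Forest.nil : Forest Unit E).leaves = w then forestAmp μ G AI
          (.nil : Forest Unit E) [] else 0 := by
      cases w <;> simp [seriesProd, Forest.leaves, forestAmp]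
    rw [this]
    refine hasSum_single Forest.nil fun f hf => ?_
    cases f <;> simp [forestAmp] at hf ⊢
  | cons y ys ih =>
    -- The empty forest has amplitude zero at a nonempty list of points; all others split into a
    -- first tree and a rest, and summing over the cuts of `w` gives the Cauchy product.
    rw [← consTree_injective.hasSum_iff]
    · have e : (fun f : Forest Unit E => if f.leaves = w then forestAmp μ G AI f (y :: ys) else 0) ∘
          consTree = fun x => ∑ k ∈ Finset.range (w.length + 1),
            (if treeLeaves x.1 = w.take k then treeValue μ G AI y x.1 else 0) *
              (if x.2.leaves = w.drop k then forestAmp μ G AI x.2 ys else 0) := by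
        funext x
        rw [← ite_append_eq, Function.comp_apply, leaves_consTree, forestAmp_consTree]
      rw [e]
      exact hasSum_sum fun k _ => hasSum_mul_of_summable_norm
        (f := fun t => if treeLeaves t = w.take k then treeValue μ G AI y t else 0)
        (g := fun f : Forest Unit E => if f.leaves = w.drop k then forestAmp μ G AI f ys else 0)
        (hr.hasSum_treeValue hTadpole hc hsum y (w.take k)) (ih (w.drop k))
        (hr.summable_norm_treeValue hTadpole hc hsum y (w.take k))
        (hr.summable_norm_forestAmp hTadpole hc hsum (w.drop k) ys)
    · intro f hf
      simp [notMem_range_consTree.1 hf, forestAmp]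

lemma treeSeries_regular (w : List E) :
    (StronglyMeasurable fun y => treeSeries μ G AI y w) ∧
      ∃ D, ∀ y, ‖treeSeries μ G AI y w‖ ≤ D := by
  obtain ⟨C, hC⟩ := hr.bdd
  have hbare : (StronglyMeasurable fun y => bare G (y :: w)) ∧ ∃ D, ∀ y, ‖bare G (y :: w)‖ ≤ D := by
    match w with
    | [] => exact ⟨stronglyMeasurable_const, 0, fun y => by simp [bare]⟩
    | [l] => exact ⟨hr.stronglyMeasurable_G_right l, C, fun y => hC y l⟩
    | _ :: _ :: _ => exact ⟨stronglyMeasurable_const, 0, fun y => by simp [bare]⟩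
  -- Measurability of the sum rests on there being countably many shapes.
  have hcount := (countable_leaves_eq w).to_subtype
  constructor
  · refine hbare.1.add ?_
    simp_rw [fun y => tsum_leaves w fun f => treeAmp μ G AI f y]
    exact StronglyMeasurable.tsum fun f => hr.stronglyMeasurable_treeAmp f.1
  · obtain ⟨D, hD⟩ := hbare.2
    have hT := hr.tsum_treeSup_ne_top hTadpole hc hsum w
    have hs := ENNReal.summable_toReal hT
    refine ⟨D + ∑' f : Forest Unit E, (if f.leaves = w then treeSup μ G AI f else 0).toReal,
      fun y => (norm_add_le _ _).trans (add_le_add (hD y) ?_)⟩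
    refine tsum_of_norm_bounded hs.hasSum fun f => ?_
    split_ifs with h
    · rw [← toReal_enorm]
      refine ENNReal.toReal_mono ?_ (le_iSup (fun y => ‖treeAmp μ G AI f y‖ₑ) y)
      have := ENNReal.ne_top_of_tsum_ne_top hT f
      rwa [if_pos h] at this
    · simp

/-- The sums over trees satisfy the planar Legendre relation. -/
lemma treeSeries_expansion (i : E) (w : List E) :
    treeSeries μ G AI i w = bare G (i :: w) + ∑ m ∈ Finset.range (w.length + 1),
      ∫ p : E × (Fin m → E), G i p.1 *
        (AI (p.1 :: List.ofFn p.2) * seriesProd ((List.ofFn p.2).map (treeSeries μ G AI)) w)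
        ∂(μ.prod (Measure.pi fun _ => μ)) := by
  rw [treeSeries]
  congr 1
  obtain ⟨C, hC⟩ := hr.bdd
  have hcount := (countable_leaves_eq w).to_subtype
  have hT := hr.tsum_ampBound_ne_top hTadpole hc hsum C w
  have hQ : ∀ f : {f : Forest Unit E | f.leaves = w}, ampBound μ G AI C f.1 ≠ ∞ := by
    intro f
    have := ENNReal.ne_top_of_tsum_ne_top hT f.1
    rwa [if_pos (show f.1.leaves = w from f.2)] at this
  have hQs : Summable fun f : {f : Forest Unit E | f.leaves = w} =>
      (ampBound μ G AI C f.1).toReal := by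
    refine ENNReal.summable_toReal ?_
    rwa [← tsum_leaves w (ampBound μ G AI C)]
  have hB : ∀ (f : {f : Forest Unit E | f.leaves = w}) (ys : List E),
      ‖forestAmp μ G AI f.1 ys‖ ≤ (ampBound μ G AI C f.1).toReal := by
    intro f ys
    rw [← toReal_enorm]
    exact ENNReal.toReal_mono (hQ f) (enorm_forestAmp_le hC f.1 ys)
  -- Sum and integral are exchanged for each `m`, the term of `f` being dominated by the `L¹` norm
  -- of the vertex times the summable `ampBound`.
  have hterm : ∀ m, HasSum (fun f : {f : Forest Unit E | f.leaves = w} =>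
      ∫ p : E × (Fin m → E), G i p.1 *
        (AI (p.1 :: List.ofFn p.2) * forestAmp μ G AI f.1 (List.ofFn p.2))
        ∂(μ.prod (Measure.pi fun _ => μ)))
      (∫ p : E × (Fin m → E), G i p.1 *
        (AI (p.1 :: List.ofFn p.2) * seriesProd ((List.ofFn p.2).map (treeSeries μ G AI)) w)
        ∂(μ.prod (Measure.pi fun _ => μ))) := by
    intro m
    have h1 : ∀ f : {f : Forest Unit E | f.leaves = w}, Integrable (fun p : E × (Fin m → E) =>
        G i p.1 * (AI (p.1 :: List.ofFn p.2) * forestAmp μ G AI f.1 (List.ofFn p.2)))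
        (μ.prod (Measure.pi fun _ => μ)) := fun f =>
      hr.integrable_vertex_mul i (φ := fun v => forestAmp μ G AI f.1 (List.ofFn v))
        ((hr.forestAmp_regular f.1).1 m) ⟨_, fun v => hB f _⟩
    have h2 := hasSum_integral_of_summable_integral_norm h1 (by
      refine Summable.of_nonneg_of_le (fun f => integral_nonneg fun p => norm_nonneg _)
        (fun f => ?_) (hQs.mul_left (C * ∫ p : E × (Fin m → E), ‖AI (p.1 :: List.ofFn p.2)‖
          ∂(μ.prod (Measure.pi fun _ => μ))))
      rw [mul_right_comm, ← integral_const_mul]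
      refine integral_mono_of_nonneg (.of_forall fun p => norm_nonneg _)
        ((hr.integrable_AI_cons m).norm.const_mul _) (.of_forall fun p => ?_)
      simp only
      calc _ ≤ C * (‖AI (p.1 :: List.ofFn p.2)‖ * (ampBound μ G AI C f.1).toReal) :=
            (norm_mul_le _ _).trans (mul_le_mul (hC _ _) ((norm_mul_le _ _).trans
              (mul_le_mul_of_nonneg_left (hB f _) (norm_nonneg _))) (norm_nonneg _)
              ((norm_nonneg _).trans (hC i i)))
        _ = _ := by ring)
    rw [← integral_congr_ae (.of_forall fun p => ?_)]
    · exact h2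
    have h3 : HasSum (fun f : {f : Forest Unit E | f.leaves = w} =>
        forestAmp μ G AI f.1 (List.ofFn p.2))
        (seriesProd ((List.ofFn p.2).map (treeSeries μ G AI)) w) := by
      refine (hasSum_subtype_iff_indicator (f := fun f : Forest Unit E =>
        forestAmp μ G AI f (List.ofFn p.2))).2 ?_
      rw [indicator_leaves]
      exact hr.hasSum_forestAmp hTadpole hc hsum (List.ofFn p.2) w
    exact ((h3.mul_left _).mul_left _).tsum_eq
  have h4 := hasSum_sum fun m (_ : m ∈ Finset.range (w.length + 1)) => hterm m
  rw [← h4.tsum_eq]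
  rw [tsum_leaves w fun f => treeAmp μ G AI f i]
  refine tsum_congr fun f => ?_
  -- A forest of children contributes only when `m` is its width; a width beyond the range means
  -- zero amplitude.
  rw [Finset.sum_eq_single f.1.width]
  · exact (hr.integral_vertex_mul i (φ := fun v => forestAmp μ G AI f.1 (List.ofFn v))
      ((hr.forestAmp_regular f.1).1 _) (hr.forestAmp_regular f.1 |>.2.imp fun D hD v => hD _)).symm
  · intro m _ hm
    simp [forestAmp_of_length_ne f.1 (List.ofFn _) (by simpa using hm)]
  · intro hw
    rw [Finset.mem_range] at hw
    have hf : f.1.leaves = w := f.2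
    simp [forestAmp_of_leaves_lt_width hTadpole f.1 (by rw [hf]; omega)]

/-- The connected Green's functions are the sums over trees. -/
lemma field_eq_treeSeries (hL : IsPlanarLegendre μ G AI W)
    (hm : ∀ u, StronglyMeasurable fun y => field W y u) (hb : ∀ u, ∃ D, ∀ y, ‖field W y u‖ ≤ D)
    (i : E) (w : List E) : field W i w = treeSeries μ G AI i w := by
  -- At the empty word only `m = 0` occurs, and this is the tadpole.
  have hnil : ∀ i, field W i [] = 0 := by
    intro i
    rw [hr.legendre_expansion hL hm hb]
    have e : ∫ p : E × (Fin 0 → E), G i p.1 * (AI (p.1 :: List.ofFn p.2) *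
        seriesProd ((List.ofFn p.2).map (field W)) []) ∂(μ.prod (Measure.pi fun _ => μ)) = 0 := by
      have hreg := seriesProd_map_regular hm hb 0 []
      rw [hr.integral_vertex_mul i hreg.1 hreg.2, Measure.pi_of_empty (x := Fin.elim0)]
      simp_rw [integral_dirac]
      simpa [seriesProd] using integral_tadpole hTadpole i
    simpa [bare] using e
  induction hn : w.length using Nat.strong_induction_on generalizing i w with
  | _ n ih =>
    subst hn
    rw [← sub_eq_zero]
    obtain ⟨D₁, hD₁⟩ := hb w
    have ht := hr.treeSeries_regular hTadpole hc hsum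
    obtain ⟨D₂, hD₂⟩ := (ht w).2
    refine hr.eq_zero_of_eq_integral hc hsum (u := fun y => field W y w - treeSeries μ G AI y w)
      ((hm w).sub (ht w).1) (D := D₁ + D₂)
      (fun y => (norm_sub_le _ _).trans (add_le_add (hD₁ y) (hD₂ y))) (fun i => ?_) i
    rcases Nat.eq_zero_or_pos w.length with h0 | hpos
    · rw [List.length_eq_zero_iff] at h0
      subst h0
      simp [hnil, hr.treeSeries_nil hTadpole]
    have hregW := fun m => seriesProd_map_regular hm hb m w
    have hregT := fun m => seriesProd_map_regular (fun u => (ht u).1) (fun u => (ht u).2) m w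
    -- Terms with `m ≠ 1` involve only coefficients at shorter words, hence cancel by induction; the
    -- term `m = 1` is linear in the coefficient at `w`, which leaves the homogeneous equation.
    rw [hr.legendre_expansion hL hm hb, hr.treeSeries_expansion hTadpole hc hsum,
      add_sub_add_left_eq_sub, ← Finset.sum_sub_distrib, Finset.sum_eq_single 1]
    · rw [← integral_sub (hr.integrable_vertex_mul i (hregW 1).1 (hregW 1).2)
        (hr.integrable_vertex_mul i (hregT 1).1 (hregT 1).2)]
      have hmp := (MeasurePreserving.id μ).prod (measurePreserving_funUnique μ (Fin 1))
      rw [← hmp.integral_comp (MeasurableEmbedding.id.prodMap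
        (MeasurableEquiv.funUnique (Fin 1) E).measurableEmbedding)]
      refine integral_congr_ae (.of_forall fun p => ?_)
      simp [seriesProd_singleton, MeasurableEquiv.funUnique, mul_sub]
    · intro m _ hm1
      rw [sub_eq_zero]
      congr 1
      funext p
      rw [seriesProd_map_congr_of_lt hnil (hr.treeSeries_nil hTadpole)
        (fun y u hu => ih u.length hu y u rfl) _ (by simpa using hm1)]
    · intro h
      rw [Finset.mem_range] at h
      omega

end IsRegular

end Expansion

/-! ### Grouping the sum over shapes by the number of inner vertices -/

section Final

open scoped Classical

universe u

variable {E : Type u} {A : Type*} [MeasurableSpace E] {μ : Measure E} [SigmaFinite μ]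
  [NormedCommRing A] [NormedAlgebra ℝ A] [CompleteSpace A] {G : E → E → A} {AI W : List E → A}

lemma stronglyMeasurable_field (hW : ∀ n, StronglyMeasurable fun v : Fin n → E => W (List.ofFn v))
    (u : List E) : StronglyMeasurable fun y => field W y u := by
  have h : Measurable fun y : E => (Fin.cons y u.get : Fin (u.length + 1) → E) := by
    refine measurable_pi_lambda _ fun i => ?_
    refine Fin.cases ?_ (fun k => ?_) i
    · simpa using measurable_id'
    · simp
  have := (hW (u.length + 1)).comp_measurable h
  simpa only [Function.comp_def, List.ofFn_cons, List.ofFn_get, field] using this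

lemma IsRegular.finsum_decreasingTrees (hr : IsRegular μ G AI) (n : ℕ) (j : E) (w : List E) :
    ∑ᶠ T ∈ decreasingTrees n j w, (T.symmetryFactor : ℝ)⁻¹ • amplitude μ G AI T.monomials =
      ∑ᶠ f ∈ {f : Forest Unit E | f.Proper ∧ f.leaves = w ∧ f.size = n},
        treeAmp μ G AI f j := by
  rw [← sum_inv_symmetryFactor n j w]
  refine finsum_mem_congr rfl fun T hT => ?_
  rw [hr.amplitude_monomials hT.1, treeAmp_erase, hT.2.1]

lemma finite_shapes (n : ℕ) (j : E) (w : List E) :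
    {f : Forest Unit E | f.Proper ∧ f.leaves = w ∧ f.size = n}.Finite := by
  rw [← image_erase_decreasingTrees n j w]
  exact (finite_decreasingTrees n j w).image _

/-- Improper shapes contribute zero, and the proper ones of a given size are finite in number. -/
lemma tsum_size_eq (hTadpole : ∀ j, onePI μ G AI [j] = 0) (n : ℕ) (j : E) (w : List E) :
    ∑' f : ↑(Forest.size ⁻¹' {n} : Set (Forest Unit E)),
      (if f.1.leaves = w then treeAmp μ G AI f.1 j else 0) =
    ∑ᶠ f ∈ {f : Forest Unit E | f.Proper ∧ f.leaves = w ∧ f.size = n}, treeAmp μ G AI f j := by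
  have hfin := finite_shapes n j w
  rw [finsum_mem_eq_finite_toFinset_sum _ hfin,
    tsum_subtype (Forest.size ⁻¹' {n} : Set (Forest Unit E))
      fun f => if f.leaves = w then treeAmp μ G AI f j else 0,
    tsum_eq_sum (s := hfin.toFinset)]
  · refine Finset.sum_congr rfl fun f hf => ?_
    rw [Set.Finite.mem_toFinset] at hf
    obtain ⟨-, h2, h3⟩ := hf
    rw [Set.indicator_of_mem (by exact h3), if_pos h2]
  · intro f hf
    rw [Set.Finite.mem_toFinset] at hf
    refine Set.indicator_apply_eq_zero.2 fun h3 => ?_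
    split_ifs with h2
    · refine treeAmp_eq_zero (fun ys => forestAmp_of_not_proper hTadpole f (fun h1 => ?_) ys) j
      exact hf ⟨h1, h2, h3⟩
    · rfl

end Final

end PlanarQFT

end

open MeasureTheory PlanarQFT in
theorem mainTheorem2 {E A : Type*} [MeasurableSpace E] (μ : Measure E) [SigmaFinite μ]
    [NormedCommRing A] [NormedAlgebra ℝ A] [CompleteSpace A]
    (G : E → E → A) (AI W : List E → A)
    (hG_symm : ∀ x y, G x y = G y x)
    (hG_meas : StronglyMeasurable (Function.uncurry G))
    (hG_bdd : ∃ C : ℝ, ∀ x y, ‖G x y‖ ≤ C)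
    (hAI : ∀ n, Integrable (fun v : Fin n → E => AI (List.ofFn v)) (Measure.pi fun _ => μ))
    (hW_meas : ∀ n, StronglyMeasurable fun v : Fin n → E => W (List.ofFn v))
    (hW_bdd : ∀ n, ∃ C : ℝ, ∀ w : List E, w.length = n → ‖W w‖ ≤ C)
    (hLegendre : IsPlanarLegendre μ G AI W)
    (hTadpole : ∀ j, onePI μ G AI [j] = 0)
    (hChain : ∃ c : ℕ → ℝ, Summable c ∧ ∀ p i j, ‖chain μ G AI p i j‖ ≤ c p)
    (j : E) (w : List E) :
    HasSum (fun n => feynmanRule μ G AI n (iterR E n (word (j :: w))))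
        (tau W (word (j :: w)) - bare G (j :: w)) ∧
      ∀ n, (decreasingTrees n j w).Finite ∧
        feynmanRule μ G AI n (iterR E n (word (j :: w))) =
          ∑ᶠ T ∈ decreasingTrees n j w,
            (T.symmetryFactor : ℝ)⁻¹ • amplitude μ G AI T.monomials := by
  classical
  refine ⟨?_, fun n => ⟨finite_decreasingTrees n j w, feynmanRule_iterR μ G AI n j w⟩⟩
  have hr : IsRegular μ G AI := ⟨hG_symm, hG_meas, hG_bdd, hAI⟩
  obtain ⟨c, hsum, hc⟩ := hChain
  have hb : ∀ u, ∃ D, ∀ y, ‖field W y u‖ ≤ D := fun u =>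
    (hW_bdd (u.length + 1)).imp fun D hD y => hD (y :: u) rfl
  have hfield := hr.field_eq_treeSeries hTadpole hc hsum hLegendre
    (stronglyMeasurable_field hW_meas) hb j w
  have hval : tau W (word (j :: w)) - bare G (j :: w) =
      ∑' f : Forest Unit E, if f.leaves = w then treeAmp μ G AI f j else 0 := by
    have e : tau W (word (j :: w)) = field W j w := by simp [tau, word, field]
    rw [e, hfield, treeSeries, add_sub_cancel_left]
  have hs : Summable fun f : Forest Unit E => if f.leaves = w then treeAmp μ G AI f j else 0 := by
    refine Summable.of_norm ?_
    convert hr.summable_norm_treeAmp hTadpole hc hsum w j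
  rw [hval]
  -- The family over all shapes is summable, so it may be grouped by size; the group of size `n` is
  -- the contribution of trees with `n` inner vertices.
  refine (hs.hasSum.tsum_fiberwise Forest.size).congr_fun fun n => ?_
  rw [feynmanRule_iterR, hr.finsum_decreasingTrees, ← tsum_size_eq hTadpole]
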